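/- Let $\mathbb F$ be a finite field and let $\mathbb V$ be the locally compact $\mathbb F$-linear space of two-sided sequences $v=(v_j)_{j\in\mathbb Z}$, $v_j\in\mathbb F$, with $v_j=0$ for all sufficiently large $j$; its topology is that of $V^\diamond\oplus V$, where $V^\diamond=\prod_{j\le 0}\mathbb F$ has the product topology and $V=\bigoplus_{j>0}\mathbb F$ is discrete. Let $\overline{\mathrm{GL}}$ be the group of all invertible continuous (with continuous inverse) $\mathbb F$-linear operators in $\mathbb V$ that preserve the Haar measure, with the topology of uniform convergence on compact sets. Put $W_m=\{v\in\mathbb V: v_j=0\text{ for } j>m\}$. For integers $\alpha_-\le\alpha_+$ and $\alpha=(\alpha_-,\alpha_+)$ let $\overline Q_\alpha\subset\overline{\mathrm{GL}}$ be the subgroup of all $g$ with $gW_{\alpha_+}=W_{\alpha_+}$, $gW_{\alpha_-}=W_{\alpha_-}$ that induce the identity on $W_{\alpha_+}/W_{\alpha_-}$. For $k\ge 0$ let $\zeta_\alpha^k\in\overline Q_\alpha\backslash\overline{\mathrm{GL}}/\overline Q_\alpha$ be the double coset of the operator that exchanges the coordinates with indices $\alpha_--k+i$ and $\alpha_++i$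 for $i=1,\dots,k$ and leaves all other coordinates unchanged. Let $\rho$ be a (strongly continuous) unitary representation of $\overline{\mathrm{GL}}$ in a complex Hilbert space $H$. Let $H_\alpha\subset H$ be the closed subspace of $\overline Q_\alpha$-fixed vectors and $P_\alpha:H\to H_\alpha$ the orthogonal projection. For a double coset $\mathfrak a\in\overline Q_\alpha\backslash\overline{\mathrm{GL}}/\overline Q_\alpha$ put $\widehat\rho_{\alpha,\alpha}(\mathfrak a)=P_\alpha\rho(A)|_{H_\alpha}:H_\alpha\to H_\alpha$ with $A\in\mathfrak a$; this does not depend on the choice of $A$. **Lemma.** Let $\rho$ be irreducible, i.e. $H\ne0$ and $H$ has no closed invariant subspaces except $0$ and $H$. Then there is exactly one complex number $z=z(\rho)$ (the spherical character of $\rho$) such that $$\widehat\rho_{\alpha,\alpha}(\zeta_\alpha^k)=z^k\cdot 1_{H_\alpha}\qquad\text{for all }\alpha=(\alpha_-,\alpha_+),\ \alpha_-\le\alpha_+,\text{ and all } k\ge 0$$ (with $z^0=1$), and this number is real and satisfies $0\le z\le 1$. -/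

import Mathlib

noncomputable section

namespace FqGL

open MeasureTheory Topology

/-! ## The locally compact space `𝕍 = V^⋄ ⊕ V` over a field -/

/-- The two-sided sequences `(v_j)_{j ∈ ℤ}` with `v_j = 0` for all sufficiently large `j`,
as a linear subspace of `ℤ → F`. -/
def twoSidedSubmodule (F : Type*) [Field F] : Submodule F (ℤ → F) where
  carrier := {v | ∃ m : ℤ, ∀ j, m < j → v j = 0}
  zero_mem' := ⟨0, fun _ _ => rfl⟩
  add_mem' := by
    rintro v w ⟨m, hm⟩ ⟨n, hn⟩
    refine ⟨max m n, fun j hj => ?_⟩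
    simp [hm j ((le_max_left _ _).trans_lt hj), hn j ((le_max_right _ _).trans_lt hj)]
  smul_mem' := by
    rintro c v ⟨m, hm⟩
    exact ⟨m, fun j hj => by simp [hm j hj]⟩

/-- The space `𝕍` of two-sided sequences that vanish far to the right. -/
def TwoSided (F : Type*) [Field F] : Type _ := ↥(twoSidedSubmodule F)

namespace TwoSided

variable {F : Type*} [Field F]

instance : AddCommGroup (TwoSided F) := inferInstanceAs (AddCommGroup ↥(twoSidedSubmodule F))

instance : Module F (TwoSided F) := inferInstanceAs (Module F ↥(twoSidedSubmodule F))

instance : CoeFun (TwoSided F) (fun _ => ℤ → F) := ⟨fun v => v.1⟩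

@[ext] theorem ext {v w : TwoSided F} (h : ∀ j, v j = w j) : v = w := Subtype.ext (funext h)

@[simp] theorem add_apply (v w : TwoSided F) (j : ℤ) : (v + w) j = v j + w j := rfl

@[simp] theorem sub_apply (v w : TwoSided F) (j : ℤ) : (v - w) j = v j - w j := rfl

@[simp] theorem smul_apply (c : F) (v : TwoSided F) (j : ℤ) : (c • v) j = c * v j := rfl

@[simp] theorem zero_apply (j : ℤ) : (0 : TwoSided F) j = 0 := rfl

/-- The splitting of a sequence into its part in `V^⋄` (indices `j ≤ 0`) and its part in `V`
(indices `j > 0`). -/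
def split : TwoSided F →+ ({j : ℤ // j ≤ 0} → F) × ({j : ℤ // 0 < j} → F) where
  toFun v := (fun j => v j, fun j => v j)
  map_zero' := rfl
  map_add' _ _ := rfl

/-- The topology of `𝕍 = V^⋄ ⊕ V`: the product of the product topology on `V^⋄` (each factor `F`
being discrete) and of the discrete topology on `V`. -/
instance : TopologicalSpace (TwoSided F) :=
  TopologicalSpace.induced split
    (@instTopologicalSpaceProd _ _ (@Pi.topologicalSpace _ _ fun _ => ⊥) ⊥)

instance : IsTopologicalAddGroup (TwoSided F) := by
  let : TopologicalSpace F := ⊥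
  have : DiscreteTopology F := ⟨rfl⟩
  let t2 : TopologicalSpace ({j : ℤ // 0 < j} → F) := ⊥
  have : DiscreteTopology ({j : ℤ // 0 < j} → F) := ⟨rfl⟩
  have : IsTopologicalAddGroup ({j : ℤ // 0 < j} → F) :=
    { continuous_add := continuous_of_discreteTopology
      continuous_neg := continuous_of_discreteTopology }
  exact topologicalAddGroup_induced (split (F := F))

/-- The subspace `W_m ⊆ 𝕍` of all sequences with `v_j = 0` for `j > m`. -/
def W (F : Type*) [Field F] (m : ℤ) : Submodule F (TwoSided F) where
  carrier := {v | ∀ j, m < j → v j = 0}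
  zero_mem' := fun _ _ => rfl
  add_mem' := fun hv hw j hj => by simp [hv j hj, hw j hj]
  smul_mem' := fun c v hv j hj => by simp [hv j hj]

theorem mem_W {m : ℤ} {v : TwoSided F} : v ∈ W F m ↔ ∀ j, m < j → v j = 0 := Iff.rfl

theorem W_mono {m n : ℤ} (h : m ≤ n) : W F m ≤ W F n := fun _ hv j hj => hv j (h.trans_lt hj)

theorem W_mem_nhds (m : ℤ) : (W F m : Set (TwoSided F)) ∈ 𝓝 (0 : TwoSided F) := by
  let : TopologicalSpace F := ⊥
  have : DiscreteTopology F := ⟨rfl⟩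
  let t2 : TopologicalSpace ({j : ℤ // 0 < j} → F) := ⊥
  have : DiscreteTopology ({j : ℤ // 0 < j} → F) := ⟨rfl⟩
  rw [nhds_induced, Filter.mem_comap]
  refine ⟨{x | ∀ j : {j : ℤ // j ≤ 0}, j ∈ {j : {j : ℤ // j ≤ 0} | m < j.1} → x j = 0} ×ˢ {0},
    ?_, ?_⟩
  · rw [map_zero, Prod.zero_eq_mk]
    refine prod_mem_nhds ?_ (by simp [nhds_discrete])
    have hfin : ({j : {j : ℤ // j ≤ 0} | m < j.1}).Finite :=
      Set.Finite.preimage Subtype.val_injective.injOn (Set.finite_Icc m 0) |>.subset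
        fun j hj => ⟨le_of_lt hj, j.2⟩
    have := set_pi_mem_nhds (x := (0 : {j : ℤ // j ≤ 0} → F)) (s := fun _ => ({0} : Set F)) hfin
      (fun i _ => by simp [nhds_discrete])
    filter_upwards [this] with x hx
    exact fun j hj => hx j hj
  · rintro v ⟨h1, h2⟩ j hj
    by_cases h0 : j ≤ 0
    · exact h1 ⟨j, h0⟩ hj
    · exact congrFun (Set.mem_singleton_iff.mp h2) ⟨j, not_le.mp h0⟩

theorem exists_W_subset {s : Set (TwoSided F)} (hs : s ∈ 𝓝 (0 : TwoSided F)) :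
    ∃ m : ℤ, (W F m : Set (TwoSided F)) ⊆ s := by
  let : TopologicalSpace F := ⊥
  have : DiscreteTopology F := ⟨rfl⟩
  let t2 : TopologicalSpace ({j : ℤ // 0 < j} → F) := ⊥
  rw [nhds_induced, Filter.mem_comap] at hs
  obtain ⟨t, ht, hts⟩ := hs
  rw [map_zero, Prod.zero_eq_mk, nhds_prod_eq, Filter.mem_prod_iff] at ht
  obtain ⟨t1, h1, t2', h2, htt⟩ := ht
  rw [nhds_pi, Filter.mem_pi] at h1
  obtain ⟨I, hI, u, hu, hut⟩ := h1
  obtain ⟨m, hm⟩ := (hI.image (fun j => j.1)).bddBelow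
  refine ⟨min (m - 1) 0, fun v hv => hts (htt ⟨hut fun j hj => ?_, ?_⟩)⟩
  · have : v j.1 = 0 := hv j.1 (by
      have := hm (Set.mem_image_of_mem _ hj)
      omega)
    change v j.1 ∈ u j
    rw [this]
    exact mem_of_mem_nhds (hu j)
  · have : (split v).2 = 0 := funext fun j => hv j.1 (by have := j.2; omega)
    rw [this]
    exact mem_of_mem_nhds h2

/-- Over a finite field, `𝕍` is locally compact: `W_0 = V^⋄` is a compact neighbourhood of `0`. -/
instance [Finite F] : LocallyCompactSpace (TwoSided F) := by
  let : TopologicalSpace F := ⊥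
  have : DiscreteTopology F := ⟨rfl⟩
  let t2 : TopologicalSpace ({j : ℤ // 0 < j} → F) := ⊥
  let ι : ({j : ℤ // j ≤ 0} → F) → TwoSided F := fun x =>
    ⟨fun j => if h : j ≤ 0 then x ⟨j, h⟩ else 0, 0, fun j hj => dif_neg (not_le.mpr hj)⟩
  have hι : Continuous ι := by
    rw [continuous_induced_rng]
    have : (split (F := F)) ∘ ι = fun x => (x, 0) := by
      funext x
      refine Prod.ext (funext fun j => dif_pos j.2) (funext fun j => dif_neg (not_le.mpr j.2))
    rw [this]
    exact continuous_id.prodMk continuous_const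
  have hc : IsCompact (W F 0 : Set (TwoSided F)) := by
    have : (W F 0 : Set (TwoSided F)) = Set.range ι := by
      ext v
      constructor
      · intro hv
        refine ⟨fun j => v j, TwoSided.ext fun j => ?_⟩
        change (if h : j ≤ 0 then v j else 0) = v j
        split_ifs with h
        · rfl
        · exact (hv j (not_le.mp h)).symm
      · rintro ⟨x, rfl⟩ j hj
        exact dif_neg (not_le.mpr hj)
    rw [this]
    exact isCompact_range hι
  exact hc.locallyCompactSpace_of_mem_nhds_of_addGroup (W_mem_nhds 0)

instance : MeasurableSpace (TwoSided F) := borel _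

instance : BorelSpace (TwoSided F) := ⟨rfl⟩

/-- A linear map that sends some `W_m` into each given `W_n` is continuous. -/
theorem continuous_of_W (L : TwoSided F →ₗ[F] TwoSided F)
    (h : ∀ n : ℤ, ∃ m : ℤ, ∀ v ∈ W F m, L v ∈ W F n) : Continuous L := by
  refine continuous_of_continuousAt_zero L.toAddMonoidHom ?_
  change Filter.Tendsto L (𝓝 0) (𝓝 (L 0))
  rw [map_zero L]
  intro s hs
  obtain ⟨n, hn⟩ := exists_W_subset hs
  obtain ⟨m, hm⟩ := h n
  exact Filter.mem_map.mpr <| Filter.mem_of_superset (W_mem_nhds m) fun v hv => hn (hm v hv)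

end TwoSided

/-! ## The group of continuous linear operators preserving the Haar measure -/

open TwoSided

/-- An invertible continuous linear operator of `𝕍`, as an automorphism of the topological additive
group `𝕍`. -/
def toAddAut {F : Type*} [Field F] (g : TwoSided F ≃L[F] TwoSided F) :
    TwoSided F ≃ₜ+ TwoSided F :=
  { g.toLinearEquiv.toAddEquiv with
    continuous_toFun := g.continuous
    continuous_invFun := g.symm.continuous }

/-- The group of all invertible continuous linear operators in `𝕍` that preserve the Haar
measure. -/
def GLbar (F : Type*) [Field F] [Finite F] : Subgroup (TwoSided F ≃L[F] TwoSided F) where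
  carrier := {g | MeasurePreserving g (Measure.addHaar : Measure (TwoSided F)) Measure.addHaar}
  one_mem' := MeasurePreserving.id _
  mul_mem' := fun ha hb => ha.comp hb
  inv_mem' := fun {g} hg => by
    have : MeasurePreserving g.toHomeomorph.toMeasurableEquiv
      (Measure.addHaar : Measure (TwoSided F)) Measure.addHaar := hg
    exact MeasurePreserving.symm _ this

/-- The topology of uniform convergence on compact sets, i.e. the compact-open topology. -/
instance {F : Type*} [Field F] [Finite F] : TopologicalSpace (GLbar F) :=
  TopologicalSpace.induced
    (fun g => (⟨g.1, g.1.continuous⟩ : C(TwoSided F, TwoSided F))) ContinuousMap.compactOpen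

/-- An involution preserves the Haar measure. -/
theorem mem_GLbar_of_mul_self {F : Type*} [Field F] [Finite F] (g : TwoSided F ≃L[F] TwoSided F)
    (h : ∀ v, g (g v) = v) : g ∈ GLbar F := by
  have h1 : addEquivAddHaarChar (toAddAut g) * addEquivAddHaarChar (toAddAut g) = 1 := by
    rw [← addEquivAddHaarChar_trans, ← addEquivAddHaarChar_refl (G := TwoSided F)]
    congr 1
    ext1 v
    exact h v
  have h2 : addEquivAddHaarChar (toAddAut g) = 1 := by
    exact (pow_eq_one_iff_of_nonneg (by positivity) two_ne_zero).mp ((sq _).trans h1)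
  have h3 := addEquivAddHaarChar_smul_map (Measure.addHaar : Measure (TwoSided F)) (toAddAut g)
  rw [h2, one_smul] at h3
  exact ⟨g.continuous.measurable, h3⟩

/-! ## The subgroups `Q_α` and the double cosets `ζ_α^k` -/

/-- Pairs `α = (α₋, α₊)` of integers with `α₋ ≤ α₊`. -/
structure Seg where
  lo : ℤ
  hi : ℤ
  le : lo ≤ hi

/-- The subgroup `Q_α` of all `g` with `g W_{α₊} = W_{α₊}`, `g W_{α₋} = W_{α₋}` that induce the
identity on `W_{α₊} / W_{α₋}`. -/
def Q (F : Type*) [Field F] [Finite F] (α : Seg) : Subgroup (GLbar F) where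
  carrier := {g | (∀ v, g.1 v ∈ W F α.hi ↔ v ∈ W F α.hi) ∧ (∀ v, g.1 v ∈ W F α.lo ↔ v ∈ W F α.lo) ∧
    ∀ v ∈ W F α.hi, g.1 v - v ∈ W F α.lo}
  one_mem' := ⟨fun _ => Iff.rfl, fun _ => Iff.rfl, fun v _ => by
    change v - v ∈ W F α.lo
    rw [sub_self]
    exact zero_mem _⟩
  mul_mem' := by
    rintro a b ⟨ha, ha', ha''⟩ ⟨hb, hb', hb''⟩
    refine ⟨fun v => (ha _).trans (hb v), fun v => (ha' _).trans (hb' v), fun v hv => ?_⟩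
    have := add_mem (ha'' (b.1 v) ((hb v).mpr hv)) (hb'' v hv)
    rwa [sub_add_sub_cancel] at this
  inv_mem' := by
    rintro a ⟨ha, ha', ha''⟩
    have e : ∀ v, a.1 ((a⁻¹).1 v) = v := fun v => a.1.apply_symm_apply v
    have hi : ∀ v, (a⁻¹).1 v ∈ W F α.hi ↔ v ∈ W F α.hi := fun v => by rw [← ha, e]
    refine ⟨hi, fun v => by rw [← ha', e], fun v hv => ?_⟩
    have := ha'' _ ((hi v).mpr hv)
    rw [e] at this
    rw [← neg_sub]
    exact neg_mem this

/-- The set of double cosets `Q_α \ GL / Q_β`. -/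
abbrev DCoset (F : Type*) [Field F] [Finite F] (α β : Seg) : Type _ :=
  DoubleCoset.Quotient (Q F α : Set (GLbar F)) (Q F β : Set (GLbar F))

/-- The permutation of indices that exchanges `α₋ - k + i` and `α₊ + i` for `i = 1, …, k`. -/
def swapFun (α : Seg) (k : ℕ) (j : ℤ) : ℤ :=
  if α.lo - k < j ∧ j ≤ α.lo then j + (α.hi - α.lo + k)
  else if α.hi < j ∧ j ≤ α.hi + k then j - (α.hi - α.lo + k)
  else j

theorem swapFun_swapFun (α : Seg) (k : ℕ) (j : ℤ) : swapFun α k (swapFun α k j) = j := by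
  have := α.le
  unfold swapFun
  split_ifs <;> omega

theorem swapFun_of_lt (α : Seg) (k : ℕ) (j : ℤ) (h : α.hi + k < j) : swapFun α k j = j := by
  have := α.le
  unfold swapFun
  split_ifs <;> omega

theorem swapFun_of_le (α : Seg) (k : ℕ) (j : ℤ) (h : j ≤ α.lo - k) : swapFun α k j = j := by
  have := α.le
  unfold swapFun
  split_ifs <;> omega

/-- The operator with the block matrix `(0 0 1_k; 0 1 0; 1_k 0 0)`, whose blocks are the index
segments `(α₋ - k, α₋]`, `(α₋, α₊]`, `(α₊, α₊ + k]`, extended by the identity. -/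
def swapLin (F : Type*) [Field F] (α : Seg) (k : ℕ) : TwoSided F →ₗ[F] TwoSided F where
  toFun v := ⟨fun j => v (swapFun α k j), by
    obtain ⟨m, hm⟩ := v.2
    refine ⟨max m (α.hi + k), fun j hj => ?_⟩
    change v (swapFun α k j) = 0
    rw [swapFun_of_lt α k j ((le_max_right _ _).trans_lt hj)]
    exact hm j ((le_max_left _ _).trans_lt hj)⟩
  map_add' _ _ := rfl
  map_smul' _ _ := rfl

theorem swapLin_swapLin {F : Type*} [Field F] (α : Seg) (k : ℕ) (v : TwoSided F) :
    swapLin F α k (swapLin F α k v) = v :=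
  TwoSided.ext fun j => congrArg v (swapFun_swapFun α k j)

theorem continuous_swapLin {F : Type*} [Field F] (α : Seg) (k : ℕ) :
    Continuous (swapLin F α k) := by
  refine continuous_of_W _ fun n => ⟨min n (α.lo - k), fun v hv j hj => ?_⟩
  change v (swapFun α k j) = 0
  apply hv
  have := α.le
  unfold swapFun
  split_ifs <;> omega

/-- `swapLin` as an element of the group. -/
def swapGL (F : Type*) [Field F] [Finite F] (α : Seg) (k : ℕ) : GLbar F :=
  ⟨{ LinearEquiv.ofInvolutive (swapLin F α k) (swapLin_swapLin α k) with
      continuous_toFun := continuous_swapLin α k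
      continuous_invFun := continuous_swapLin α k },
    mem_GLbar_of_mul_self _ (swapLin_swapLin α k)⟩

/-- The double coset `ζ_α^k`. -/
def zetaCoset (F : Type*) [Field F] [Finite F] (α : Seg) (k : ℕ) : DCoset F α α :=
  DoubleCoset.mk (Q F α) (Q F α) (swapGL F α k)

/-! ## Unitary representations and the spherical character -/

section Rep

variable {F : Type*} [Field F] [Finite F]
  {H : Type*} [NormedAddCommGroup H] [InnerProductSpace ℂ H]

/-- A unitary representation of the topological group: a homomorphism to the unitary group of `H`
that is strongly continuous. -/
structure UnitaryRep (F : Type*) [Field F] [Finite F]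
    (H : Type*) [NormedAddCommGroup H] [InnerProductSpace ℂ H] where
  toHom : GLbar F →* (H ≃ₗᵢ[ℂ] H)
  continuous' : ∀ h : H, Continuous fun g => toHom g h

instance : CoeFun (UnitaryRep F H) (fun _ => GLbar F → (H ≃ₗᵢ[ℂ] H)) := ⟨fun ρ => ρ.toHom⟩

/-- Irreducibility: `H` is nonzero and has no closed invariant subspaces except `0` and `H`. -/
def UnitaryRep.IsIrreducible (ρ : UnitaryRep F H) : Prop :=
  Nontrivial H ∧ ∀ K : Submodule ℂ H, IsClosed (K : Set H) →
    (∀ g, ∀ h ∈ K, ρ g h ∈ K) → K = ⊥ ∨ K = ⊤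

/-- The subspace `H_α` of `Q_α`-fixed vectors. -/
def UnitaryRep.fixed (ρ : UnitaryRep F H) (α : Seg) : Submodule ℂ H where
  carrier := {h | ∀ g ∈ Q F α, ρ g h = h}
  zero_mem' := fun g _ => map_zero (ρ g)
  add_mem' := fun ha hb g hg => by rw [map_add, ha g hg, hb g hg]
  smul_mem' := fun c h hh g hg => by rw [map_smul, hh g hg]

theorem UnitaryRep.isClosed_fixed (ρ : UnitaryRep F H) (α : Seg) :
    IsClosed (ρ.fixed α : Set H) := by
  have : (ρ.fixed α : Set H) = ⋂ g ∈ Q F α, {h | ρ g h = h} := by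
    ext h
    simp only [Set.mem_iInter]
    rfl
  rw [this]
  exact isClosed_biInter fun g _ => isClosed_eq (ρ g).continuous continuous_id

instance [CompleteSpace H] (ρ : UnitaryRep F H) (α : Seg) : CompleteSpace (ρ.fixed α) :=
  (ρ.isClosed_fixed α).completeSpace_coe

variable [CompleteSpace H]

/-- The operator `P_α ρ(g) : H_β → H_α`, where `P_α` is the orthogonal projection `H → H_α`. -/
def UnitaryRep.compress (ρ : UnitaryRep F H) (α β : Seg) (g : GLbar F) :
    ρ.fixed β →L[ℂ] ρ.fixed α :=
  (ρ.fixed α).orthogonalProjectionOnto ∘L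
    (ρ g).toContinuousLinearEquiv.toContinuousLinearMap ∘L (ρ.fixed β).subtypeL

/-- The operator `P_α ρ(g)|_{H_β}` depends only on the double coset of `g`. -/
theorem UnitaryRep.compress_eq (ρ : UnitaryRep F H) (α β : Seg) {g g' : GLbar F}
    (h : DoubleCoset.setoid (Q F α : Set (GLbar F)) (Q F β : Set (GLbar F)) g g') :
    ρ.compress α β g = ρ.compress α β g' := by
  obtain ⟨a, ha, b, hb, rfl⟩ := DoubleCoset.rel_iff.mp h
  ext1 x
  change (ρ.fixed α).orthogonalProjectionOnto (ρ g x) =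
    (ρ.fixed α).orthogonalProjectionOnto (ρ (a * g * b) x)
  have hx : ρ (a * g * b) x = ρ a (ρ g x) := by
    have hbx : ρ b (x : H) = x := x.2 b hb
    rw [map_mul, map_mul]
    change ρ a (ρ g (ρ b (x : H))) = _
    rw [hbx]
  rw [hx]
  refine ext_inner_right ℂ fun y => ?_
  have hy : ρ a (y : H) = y := y.2 a ha
  rw [Submodule.inner_orthogonalProjectionOnto_eq_of_mem_right,
    Submodule.inner_orthogonalProjectionOnto_eq_of_mem_right]
  conv_rhs => rw [← hy]
  rw [LinearIsometryEquiv.inner_map_map]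

/-- The operator `ρ̂_{α,β}(𝔞) : H_β → H_α` attached to a double coset `𝔞 ∈ Q_α \ GL / Q_β`. -/
def UnitaryRep.hat (ρ : UnitaryRep F H) (α β : Seg) (a : DCoset F α β) :
    ρ.fixed β →L[ℂ] ρ.fixed α :=
  Quotient.lift (ρ.compress α β) (fun _ _ h => ρ.compress_eq α β h) a

/-- `z` is the spherical character of `ρ`: for all `α` and `k ≥ 0`, the double coset `ζ_α^k` acts
on `H_α` as the scalar `z ^ k`. -/
def UnitaryRep.IsSphericalCharacter (ρ : UnitaryRep F H) (z : ℂ) : Prop :=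
  ∀ (α : Seg) (k : ℕ), ρ.hat α α (zetaCoset F α k) = z ^ k • ContinuousLinearMap.id ℂ (ρ.fixed α)

end Rep

end FqGL

end

/-! Fix `k` and let J_n be the swap of `k` coordinates at the two ends of the segment (-n, n]. As n
grows, J_n moves away from any finite set of coordinates: it commutes with every operator supported
in (a, b] once that segment lies in (-n, n]. So a weak limit S of ρ(J_n) commutes with ρ of all
finitely supported operators. These are dense (`exists_isSupportedIn_mem_Q`, `exists_Q_subset`);
preservation of volume is what makes the required dimension count work. Since the J_n are
involutions, S is self-adjoint, and by Schur's lemma (`exists_eq_smul_of_isSelfAdjoint`) it is a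
real scalar r_k. On `H_α` the limit is already attained: for large n a coordinate permutation from
`Q_α` conjugates J_n to the representative of ζ_α^k (`exists_perm_swapPerm_far`). Hence ζ_α^k acts
on every `H_α` by the same r_k.

Multiplicativity r_{k+l} = r_k r_l holds because, up to conjugation by `Q_α`, the swap of k + l
coordinates at α is a swap of k at α followed by a swap of l at the enlarged segment, and the first
one maps `H_α` into the fixed space of the enlarged segment (`inner_swapGL_add`). So r_k = z^k with
z = r_1.

The bound z ≤ 1 is Cauchy–Schwarz. For z ≥ 0, transpositions of α₊ + 1 with the infinitely many
indices below or at α₋ turn a fixed unit vector into infinitely many unit vectors with pairwise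
inner product z, which is impossible for negative z. Uniqueness needs only one nonzero fixed vector,
found by a convexity argument (`exists_mem_fixed_ne_zero`). -/

noncomputable section

namespace FqGL

open MeasureTheory Topology TwoSided Filter

/-! ### Truncations, and the compact open subspaces `W_m`. -/

namespace TwoSided

variable {F : Type*} [Field F]

/-- The sequences supported in the segment `(a, b]`. -/
def segment (F : Type*) [Field F] (a b : ℤ) : Submodule F (TwoSided F) where
  carrier := {v | ∀ j, ¬(a < j ∧ j ≤ b) → v j = 0}
  zero_mem' := fun _ _ => rfl
  add_mem' := fun hv hw j hj => by simp [hv j hj, hw j hj]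
  smul_mem' := fun c v hv j hj => by simp [hv j hj]

/-- Truncation of a sequence to the segment `(a, b]`. -/
def trunc (F : Type*) [Field F] (a b : ℤ) : TwoSided F →ₗ[F] TwoSided F where
  toFun v := ⟨fun j => if a < j ∧ j ≤ b then v j else 0, b, fun j hj => if_neg (by omega)⟩
  map_add' v w := TwoSided.ext fun j => by
    change (if _ then (v + w) j else 0) = (if _ then v j else 0) + (if _ then w j else 0)
    split_ifs <;> simp
  map_smul' c v := TwoSided.ext fun j => by
    change (if _ then (c • v) j else 0) = c * (if _ then v j else 0)
    split_ifs <;> simp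

theorem trunc_apply (a b : ℤ) (v : TwoSided F) (j : ℤ) :
    trunc F a b v j = if a < j ∧ j ≤ b then v j else 0 := rfl

theorem trunc_mem_segment (a b : ℤ) (v : TwoSided F) : trunc F a b v ∈ segment F a b :=
  fun _ hj => if_neg hj

theorem trunc_eq_self {a b : ℤ} {v : TwoSided F} (hv : v ∈ segment F a b) : trunc F a b v = v :=
  TwoSided.ext fun j => by
    rw [trunc_apply]
    split_ifs with h
    · rfl
    · exact (hv j h).symm

theorem trunc_eq_zero {a b : ℤ} {v : TwoSided F} (hv : v ∈ W F a) : trunc F a b v = 0 :=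
  TwoSided.ext fun j => by
    rw [trunc_apply]
    split_ifs with h
    · exact hv j h.1
    · rfl

theorem sub_trunc_mem_W {a b : ℤ} {v : TwoSided F} (hv : v ∈ W F b) : v - trunc F a b v ∈ W F a :=
  fun j hj => by
    rw [sub_apply, trunc_apply]
    split_ifs with h
    · exact sub_self _
    · rw [hv j (by omega), sub_zero]

theorem segment_le_W {a b n : ℤ} (h : b ≤ n) : segment F a b ≤ W F n :=
  fun _ hv j hj => hv j (by omega)

theorem segment_mono {a b a' b' : ℤ} (ha : a' ≤ a) (hb : b ≤ b') :
    segment F a b ≤ segment F a' b' :=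
  fun _ hv j hj => hv j (by omega)

theorem eq_zero_of_mem_segment_of_mem_W {a b : ℤ} {v : TwoSided F} (hv : v ∈ segment F a b)
    (hw : v ∈ W F a) : v = 0 :=
  TwoSided.ext fun j => by
    by_cases h : a < j
    · exact hw j h
    · exact hv j (by omega)

instance [Finite F] (a b : ℤ) : Finite (segment F a b) := by
  refine Finite.of_injective (fun (v : segment F a b) (j : Set.Ioc a b) => v.1 j) fun v w h => ?_
  refine Subtype.ext (TwoSided.ext fun j => ?_)
  by_cases hj : a < j ∧ j ≤ b
  · exact congrFun h ⟨j, hj⟩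
  · rw [v.2 j hj, w.2 j hj]

theorem isOpen_submodule_of_W_le {X : Submodule F (TwoSided F)} {m : ℤ} (h : W F m ≤ X) :
    IsOpen (X : Set (TwoSided F)) :=
  X.toAddSubgroup.isOpen_of_mem_nhds (g := 0) (Filter.mem_of_superset (W_mem_nhds m) h)

theorem isOpen_W (m : ℤ) : IsOpen (W F m : Set (TwoSided F)) := isOpen_submodule_of_W_le le_rfl

theorem isClosed_W (m : ℤ) : IsClosed (W F m : Set (TwoSided F)) :=
  AddSubgroup.isClosed_of_isOpen (W F m).toAddSubgroup (isOpen_W m)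

/-- Some small `W_k` lies in a compact neighbourhood of 0, and `W_m` consists of finitely many
translates of it or of itself. -/
theorem isCompact_W [Finite F] (m : ℤ) : IsCompact (W F m : Set (TwoSided F)) := by
  obtain ⟨K, hK, hK0⟩ := exists_compact_mem_nhds (0 : TwoSided F)
  obtain ⟨k, hk⟩ := exists_W_subset hK0
  have h1 : IsCompact (W F (min k m) : Set (TwoSided F)) :=
    hK.of_isClosed_subset (isClosed_W _) (fun v hv => hk (W_mono (min_le_left k m) hv))
  have h2 : IsCompact (segment F (min k m) m : Set (TwoSided F)) :=
    (Set.finite_coe_iff.mp (inferInstanceAs (Finite (segment F (min k m) m)))).isCompact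
  convert h2.add h1 using 1
  ext v
  constructor
  · intro hv
    exact ⟨trunc F _ m v, trunc_mem_segment _ _ v, v - trunc F _ m v, sub_trunc_mem_W hv,
      add_sub_cancel _ _⟩
  · rintro ⟨a, ha, b, hb, rfl⟩
    exact add_mem (segment_le_W le_rfl ha) (W_mono (min_le_right _ _) hb)

theorem exists_subset_W_of_isCompact {K : Set (TwoSided F)} (hK : IsCompact K) :
    ∃ n : ℤ, ∀ m, n ≤ m → K ⊆ W F m := by
  obtain ⟨n, hn⟩ := hK.elim_directed_cover (fun m : ℤ => (W F m : Set (TwoSided F))) isOpen_W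
    (fun v _ => by
      obtain ⟨m, hm⟩ := v.2
      exact Set.mem_iUnion.mpr ⟨m, hm⟩)
    (directed_of_isDirected_le fun _ _ h => W_mono h)
  exact ⟨n, fun m hm => hn.trans (W_mono hm)⟩

/-! ### Volumes of subspaces between two `W_m`. -/

section Haar

variable [Finite F]

theorem addHaar_W_ne_zero (m : ℤ) : (Measure.addHaar : Measure (TwoSided F)) (W F m) ≠ 0 :=
  ((isOpen_W m).measure_pos _ ⟨0, zero_mem _⟩).ne'

theorem addHaar_W_ne_top (m : ℤ) : (Measure.addHaar : Measure (TwoSided F)) (W F m) ≠ ⊤ :=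
  (isCompact_W m).measure_lt_top.ne

/-- The volume of an intermediate subspace `W_m ≤ X ≤ W_n`. -/
theorem addHaar_submodule {X : Submodule F (TwoSided F)} {m n : ℤ} (hm : W F m ≤ X)
    (hn : X ≤ W F n) :
    (Measure.addHaar : Measure (TwoSided F)) X =
      Nat.card ↥(X ⊓ segment F m n) * (Measure.addHaar : Measure (TwoSided F)) (W F m) := by
  have hfin : Finite ↥(X ⊓ segment F m n) :=
    Finite.of_injective _ (Submodule.inclusion_injective (inf_le_right (a := X)))
  -- `X` is the disjoint union of the cosets e + `W_m`, with the elements e of `X` supported in (m,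
  -- n] as representatives.
  have hX : (X : Set (TwoSided F)) =
      ⋃ e : ↥(X ⊓ segment F m n), (fun v => -(e : TwoSided F) + v) ⁻¹' (W F m) := by
    ext v
    simp only [Set.mem_iUnion]
    constructor
    · intro hv
      have h1 := sub_trunc_mem_W (a := m) (hn hv)
      refine ⟨⟨trunc F m n v, ?_, trunc_mem_segment _ _ v⟩, ?_⟩
      · have := X.sub_mem hv (hm h1)
        rwa [sub_sub_cancel] at this
      · change -(trunc F m n v) + v ∈ W F m
        rwa [neg_add_eq_sub]
    · rintro ⟨e, he⟩
      have := X.add_mem e.2.1 (hm he)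
      rwa [add_neg_cancel_left] at this
  rw [hX, measure_iUnion, tsum_congr (fun e => measure_preimage_add _ _ _)]
  · rw [ENNReal.tsum_const, ENat.card_eq_coe_natCard]
    rfl
  · intro e e' hee
    refine Set.disjoint_left.mpr fun v h1 h2 => hee (Subtype.ext ?_)
    have h3 := (W F m).sub_mem h2 h1
    rw [add_sub_add_right_eq_sub, neg_sub_neg] at h3
    exact sub_eq_zero.mp (eq_zero_of_mem_segment_of_mem_W (sub_mem e.2.2 e'.2.2) h3)
  · intro e
    exact ((isOpen_W m).preimage (continuous_const.add continuous_id)).measurableSet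

/-- A subspace of `W_n` of full volume is `W_n`. -/
theorem eq_W_of_addHaar_eq {X : Submodule F (TwoSided F)} {m n : ℤ} (hm : W F m ≤ X)
    (hn : X ≤ W F n)
    (h : (Measure.addHaar : Measure (TwoSided F)) X = Measure.addHaar (W F n : Set (TwoSided F))) :
    X = W F n := by
  refine le_antisymm hn fun v hv => by_contra fun hvX => ?_
  have hopen := isOpen_submodule_of_W_le hm
  have h0 : (Measure.addHaar : Measure (TwoSided F)) ((W F n : Set (TwoSided F)) \ X) = 0 := by
    rw [measure_sdiff hn hopen.measurableSet.nullMeasurableSet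
      (by rw [h]; exact addHaar_W_ne_top n), h, tsub_self]
  refine ((IsOpen.sdiff (isOpen_W n)
    (AddSubgroup.isClosed_of_isOpen X.toAddSubgroup hopen)).measure_pos _ ⟨v, hv, hvX⟩).ne' h0

end Haar

end TwoSided

/-! ### The action of the group on the `W_m`, and the `Q_α` as small subgroups. -/

variable {F : Type*} [Field F] [Finite F]

theorem addHaar_preimage_W (g : GLbar F) (X : Submodule F (TwoSided F))
    (hX : IsOpen (X : Set (TwoSided F))) :
    (Measure.addHaar : Measure (TwoSided F))
      (X.comap (g.1 : TwoSided F →ₗ[F] TwoSided F) : Submodule F (TwoSided F)) =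
      Measure.addHaar (X : Set (TwoSided F)) :=
  g.2.measure_preimage hX.measurableSet.nullMeasurableSet

/-- A continuous operator that preserves some `W_m` preserves the Haar measure. -/
theorem mem_GLbar_of_W (g : TwoSided F ≃L[F] TwoSided F) (m : ℤ)
    (h : ∀ v, g v ∈ W F m ↔ v ∈ W F m) : g ∈ GLbar F := by
  -- The modulus of `g` can be read off from one set of finite nonzero volume.
  have h1 := addEquivAddHaarChar_smul_preimage
    (Measure.addHaar : Measure (TwoSided F)) (X := (W F m : Set (TwoSided F))) (toAddAut g)
  have h2 : (toAddAut g) ⁻¹' (W F m : Set (TwoSided F)) = W F m := Set.ext h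
  rw [h2, ENNReal.smul_def, smul_eq_mul] at h1
  have h3 : addEquivAddHaarChar (toAddAut g) = 1 := by
    have := (ENNReal.mul_eq_right (addHaar_W_ne_zero m) (addHaar_W_ne_top m)).mp h1
    exact_mod_cast this
  have h4 := addEquivAddHaarChar_smul_map (Measure.addHaar : Measure (TwoSided F)) (toAddAut g)
  rw [h3, one_smul] at h4
  exact ⟨g.continuous.measurable, h4⟩

theorem apply_inv_apply (g : GLbar F) (v : TwoSided F) : g.1 ((g⁻¹).1 v) = v :=
  g.1.apply_symm_apply v

theorem inv_apply_apply (g : GLbar F) (v : TwoSided F) : (g⁻¹).1 (g.1 v) = v :=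
  g.1.symm_apply_apply v

theorem exists_W_le_comap (g : GLbar F) (n : ℤ) :
    ∃ k : ℤ, ∀ m ≤ k, ∀ v ∈ W F m, g.1 v ∈ W F n := by
  have h : g.1 ⁻¹' (W F n : Set (TwoSided F)) ∈ 𝓝 0 := by
    refine g.1.continuous.continuousAt.preimage_mem_nhds ?_
    rw [map_zero g.1]
    exact W_mem_nhds n
  obtain ⟨k, hk⟩ := exists_W_subset h
  exact ⟨k, fun m hm v hv => hk (W_mono hm hv)⟩

theorem exists_map_W_le (g : GLbar F) (n : ℤ) :
    ∃ k : ℤ, ∀ m, k ≤ m → ∀ v ∈ W F n, g.1 v ∈ W F m := by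
  obtain ⟨k, hk⟩ := exists_subset_W_of_isCompact ((isCompact_W n).image g.1.continuous)
  exact ⟨k, fun m hm v hv => hk m hm (Set.mem_image_of_mem _ hv)⟩

/-- An operator of the group that maps `W_n` into itself maps it onto itself. -/
theorem apply_mem_W_iff (g : GLbar F) {n : ℤ} (h : ∀ v ∈ W F n, g.1 v ∈ W F n) (v : TwoSided F) :
    g.1 v ∈ W F n ↔ v ∈ W F n := by
  refine ⟨fun hv => ?_, h v⟩
  obtain ⟨k, hk⟩ := exists_W_le_comap g⁻¹ n
  -- This comap is the image `g W_n`. It lies in `W_n` and has the same volume, so it is all of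
  -- `W_n`.
  have hX : (W F n).comap ((g⁻¹).1 : TwoSided F →ₗ[F] TwoSided F) ≤ W F n := fun w hw => by
    have : g.1 ((g⁻¹).1 w) ∈ W F n := h _ hw
    rwa [apply_inv_apply] at this
  have := eq_W_of_addHaar_eq (hk k le_rfl) hX (addHaar_preimage_W _ _ (isOpen_W n))
  have h2 : g.1 v ∈ (W F n).comap ((g⁻¹).1 : TwoSided F →ₗ[F] TwoSided F) := by rwa [this]
  change (g⁻¹).1 (g.1 v) ∈ W F n at h2
  rwa [inv_apply_apply] at h2

/-- The congruence alone shows that `g` maps both subspaces into themselves; preservation of volume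
then forces equality. -/
theorem mem_Q_of_sub_mem {α : Seg} {g : GLbar F}
    (h : ∀ v ∈ W F α.hi, g.1 v - v ∈ W F α.lo) : g ∈ Q F α := by
  refine ⟨apply_mem_W_iff g fun v hv => ?_, apply_mem_W_iff g fun v hv => ?_, h⟩
  · have := add_mem (W_mono α.le (h v hv)) hv
    rwa [sub_add_cancel] at this
  · have := add_mem (h v (W_mono α.le hv)) hv
    rwa [sub_add_cancel] at this

theorem Q_anti {α β : Seg} (h1 : β.lo ≤ α.lo) (h2 : α.hi ≤ β.hi) : Q F β ≤ Q F α :=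
  fun _ hg => mem_Q_of_sub_mem fun v hv => W_mono h1 (hg.2.2 v (W_mono h2 hv))

/-- Every neighbourhood of `1` contains one of the subgroups `Q_α`. -/
theorem exists_Q_subset {U : Set (GLbar F)} (hU : U ∈ 𝓝 (1 : GLbar F)) :
    ∃ α : Seg, (Q F α : Set (GLbar F)) ⊆ U := by
  have key : ∀ A : Set C(TwoSided F, TwoSided F), A ∈ 𝓝 (ContinuousMap.id (TwoSided F)) →
      ∃ α : Seg, ∀ g ∈ Q F α, (⟨g.1, g.1.continuous⟩ : C(TwoSided F, TwoSided F)) ∈ A := by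
    have hle : (⨅ α : Seg, Filter.principal
        {f : C(TwoSided F, TwoSided F) | ∀ v ∈ W F α.hi, f v - v ∈ W F α.lo}) ≤
        𝓝 (ContinuousMap.id (TwoSided F)) := by
      rw [ContinuousMap.nhds_compactOpen]
      refine le_iInf₂ fun K hK => le_iInf₂ fun O hO => le_iInf fun hKO => ?_
      -- If `K + V ⊆ O`, `W_m ⊆ V` and `K ⊆ W_n`, then every map that moves the points of `W_n` by
      -- elements of `W_m` sends `K` into `O`.
      obtain ⟨V, hV, hVO⟩ := compact_open_separated_add_right hK hO hKO
      obtain ⟨m, hm⟩ := exists_W_subset hV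
      obtain ⟨n, hn⟩ := exists_subset_W_of_isCompact hK
      refine iInf_le_of_le ⟨m, max m n, le_max_left _ _⟩ (Filter.principal_mono.mpr ?_)
      intro f hf v hv
      have := hf v (hn _ (le_max_right _ _) hv)
      refine hVO ⟨v, hv, f v - v, hm this, add_sub_cancel _ _⟩
    intro A hA
    have : Nonempty Seg := ⟨⟨0, 0, le_rfl⟩⟩
    have hA' := hle hA
    rw [Filter.mem_iInf_of_directed] at hA'
    · obtain ⟨α, hα⟩ := hA'
      exact ⟨α, fun g hg => Filter.mem_principal.mp hα hg.2.2⟩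
    · intro α β
      refine ⟨⟨min α.lo β.lo, max α.hi β.hi,
        (min_le_left _ _).trans (α.le.trans (le_max_left _ _))⟩,
        Filter.principal_mono.mpr ?_, Filter.principal_mono.mpr ?_⟩
      · exact fun f hf v hv => W_mono (min_le_left _ _) (hf v (W_mono (le_max_left _ _) hv))
      · exact fun f hf v hv => W_mono (min_le_right _ _) (hf v (W_mono (le_max_right _ _) hv))
  rw [nhds_induced, Filter.mem_comap] at hU
  obtain ⟨A, hA, hAU⟩ := hU
  obtain ⟨α, hα⟩ := key A hA
  exact ⟨α, fun g hg => hAU (hα g hg)⟩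

/-! ### Operators with finite support and their density. -/

/-- An injective linear map from a subspace of a finite-dimensional space into the space extends
to an automorphism. -/
theorem exists_linearEquiv_extend {K E : Type*} [Field K] [AddCommGroup E] [Module K E]
    [FiniteDimensional K E] (D : Submodule K E) (f : D →ₗ[K] E) (hf : Function.Injective f) :
    ∃ A : E ≃ₗ[K] E, ∀ d : D, A d = f d := by
  obtain ⟨C, hC⟩ := D.exists_isCompl
  obtain ⟨C', hC'⟩ := (LinearMap.range f).exists_isCompl
  have h1 := Submodule.finrank_add_eq_of_isCompl hC
  have h2 := Submodule.finrank_add_eq_of_isCompl hC'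
  rw [LinearMap.finrank_range_of_inj hf] at h2
  let φ : C ≃ₗ[K] C' := LinearEquiv.ofFinrankEq _ _ (by omega)
  refine ⟨(Submodule.prodEquivOfIsCompl D C hC).symm ≪≫ₗ
    ((LinearEquiv.ofInjective f hf).prodCongr φ) ≪≫ₗ
    Submodule.prodEquivOfIsCompl _ C' hC', fun d => ?_⟩
  have : (Submodule.prodEquivOfIsCompl D C hC).symm d = (d, 0) := by
    rw [LinearEquiv.symm_apply_eq]
    simp
  simp [this]

variable {F : Type*} [Field F]

/-- The operator acting by `A` on the sequences supported in `(a, b]` and identically on the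
sequences that vanish there. -/
def blockLin (a b : ℤ) (A : segment F a b →ₗ[F] segment F a b) : TwoSided F →ₗ[F] TwoSided F :=
  LinearMap.id - trunc F a b +
    (segment F a b).subtype ∘ₗ A ∘ₗ (trunc F a b).codRestrict _ (trunc_mem_segment a b)

theorem blockLin_apply (a b : ℤ) (A : segment F a b →ₗ[F] segment F a b) (v : TwoSided F) :
    blockLin a b A v = v - trunc F a b v + A ⟨trunc F a b v, trunc_mem_segment a b v⟩ := rfl

theorem blockLin_of_mem {a b : ℤ} (A : segment F a b →ₗ[F] segment F a b) (v : segment F a b) :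
    blockLin a b A v = A v := by
  rw [blockLin_apply]
  simp only [trunc_eq_self v.2, sub_self, zero_add]

theorem blockLin_of_trunc_eq_zero {a b : ℤ} (A : segment F a b →ₗ[F] segment F a b)
    {v : TwoSided F} (hv : trunc F a b v = 0) : blockLin a b A v = v := by
  rw [blockLin_apply]
  have : (⟨trunc F a b v, trunc_mem_segment a b v⟩ : segment F a b) = 0 := Subtype.ext hv
  rw [this, map_zero, hv]
  simp

theorem blockLin_comp {a b : ℤ} (A B : segment F a b →ₗ[F] segment F a b)
    (h : ∀ v, A (B v) = v) (v : TwoSided F) : blockLin a b A (blockLin a b B v) = v := by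
  have h0 : trunc F a b (v - trunc F a b v) = 0 := by
    rw [map_sub, trunc_eq_self (trunc_mem_segment a b v), sub_self]
  rw [blockLin_apply a b B, map_add, blockLin_of_trunc_eq_zero A h0, blockLin_of_mem, h]
  exact sub_add_cancel _ _

theorem blockLin_mem_W {a b : ℤ} (A : segment F a b →ₗ[F] segment F a b) {m : ℤ} (h : m ≤ a)
    {v : TwoSided F} (hv : v ∈ W F m) : blockLin a b A v = v :=
  blockLin_of_trunc_eq_zero A (trunc_eq_zero (W_mono h hv))

theorem continuous_blockLin {a b : ℤ} (A : segment F a b →ₗ[F] segment F a b) :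
    Continuous (blockLin a b A) :=
  continuous_of_W _ fun n => ⟨min n a, fun v hv => by
    rw [blockLin_mem_W A (min_le_right n a) hv]
    exact W_mono (min_le_left _ _) hv⟩

variable [Finite F]

/-- `blockLin` for an invertible block, as a continuous operator. -/
def blockEquiv (a b : ℤ) (A : segment F a b ≃ₗ[F] segment F a b) : TwoSided F ≃L[F] TwoSided F where
  toLinearEquiv := LinearEquiv.ofLinearMap (blockLin a b A.toLinearMap)
    (blockLin a b A.symm.toLinearMap)
    (LinearMap.ext (blockLin_comp _ _ A.apply_symm_apply))
    (LinearMap.ext (blockLin_comp _ _ A.symm_apply_apply))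
  continuous_toFun := continuous_blockLin A.toLinearMap
  continuous_invFun := continuous_blockLin A.symm.toLinearMap

/-- `blockEquiv` as an element of the group. -/
def blockGL (a b : ℤ) (A : segment F a b ≃ₗ[F] segment F a b) : GLbar F :=
  ⟨blockEquiv a b A, by
    refine mem_GLbar_of_W _ a fun v => ?_
    change blockLin a b A.toLinearMap v ∈ W F a ↔ v ∈ W F a
    have h : ∀ (B : segment F a b →ₗ[F] segment F a b), ∀ w ∈ W F a, blockLin a b B w ∈ W F a :=
      fun B w hw => by rwa [blockLin_mem_W B le_rfl hw]
    refine ⟨fun hv => ?_, h _ v⟩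
    have := h A.symm.toLinearMap _ hv
    rwa [blockLin_comp _ _ A.symm_apply_apply] at this⟩

/-- The operators that act on the coordinates from `(a, b]` only. -/
def IsSupportedIn (g : GLbar F) (a b : ℤ) : Prop :=
  (∀ v ∈ segment F a b, g.1 v ∈ segment F a b) ∧ ∀ v, trunc F a b v = 0 → g.1 v = v

theorem isSupportedIn_blockGL (a b : ℤ) (A : segment F a b ≃ₗ[F] segment F a b) :
    IsSupportedIn (blockGL a b A) a b :=
  ⟨fun v hv => by
    change blockLin a b A.toLinearMap v ∈ _
    rw [blockLin_of_mem A.toLinearMap ⟨v, hv⟩]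
    exact (A ⟨v, hv⟩).2, fun _ hv => blockLin_of_trunc_eq_zero A.toLinearMap hv⟩

theorem swapFun_of_mem (α : Seg) (k : ℕ) (j : ℤ) (h : α.lo < j ∧ j ≤ α.hi) :
    swapFun α k j = j := by
  unfold swapFun
  split_ifs <;> omega

theorem swapFun_mem_iff (α : Seg) (k : ℕ) (j : ℤ) :
    (α.lo < swapFun α k j ∧ swapFun α k j ≤ α.hi) ↔ (α.lo < j ∧ j ≤ α.hi) := by
  have := α.le
  unfold swapFun
  split_ifs <;> omega

theorem swapGL_apply (α : Seg) (k : ℕ) (v : TwoSided F) (j : ℤ) :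
    (swapGL F α k).1 v j = v (swapFun α k j) := rfl

/-- The swap fixes all coordinates in (α₋, α₊] and permutes the others among themselves, while `g`
acts only inside (a, b]. The two operators thus act on disjoint sets of coordinates. -/
theorem IsSupportedIn.commute_swapGL {g : GLbar F} {a b : ℤ} (hg : IsSupportedIn g a b)
    {α : Seg} (ha : α.lo ≤ a) (hb : b ≤ α.hi) (k : ℕ) :
    g * swapGL F α k = swapGL F α k * g := by
  have hJ : ∀ e ∈ segment F a b, (swapGL F α k).1 e = e := fun e he => TwoSided.ext fun j => by
    rw [swapGL_apply]
    by_cases h : α.lo < j ∧ j ≤ α.hi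
    · rw [swapFun_of_mem α k j h]
    · rw [he j (by omega), he]
      intro h'
      exact h ((swapFun_mem_iff α k j).mp ⟨by omega, by omega⟩)
  refine Subtype.ext (ContinuousLinearEquiv.ext (funext fun v => ?_))
  change g.1 ((swapGL F α k).1 v) = (swapGL F α k).1 (g.1 v)
  have h0 : trunc F a b (v - trunc F a b v) = 0 := by
    rw [map_sub, trunc_eq_self (trunc_mem_segment a b v), sub_self]
  have h1 : trunc F a b ((swapGL F α k).1 (v - trunc F a b v)) = 0 := TwoSided.ext fun j => by
    rw [trunc_apply]
    split_ifs with h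
    · rw [swapGL_apply, swapFun_of_mem α k j (by omega)]
      simp [trunc_apply, h]
    · rfl
  have hv : v = (v - trunc F a b v) + trunc F a b v := (sub_add_cancel _ _).symm
  rw [hv, map_add, map_add, map_add, map_add, hJ _ (trunc_mem_segment a b v),
    hJ _ (hg.1 _ (trunc_mem_segment a b v)), hg.2 _ h0, hg.2 _ h1]

/-- A preimage of `W_l` has as many points as `W_l` modulo a common subspace `W_m`. -/
theorem card_comap_inf_segment (g : GLbar F) {l m n : ℤ} (hmn : l ≤ n) (hml : m ≤ l)
    (h1 : ∀ v ∈ W F m, g.1 v ∈ W F l) (h2 : ∀ v ∈ W F l, (g⁻¹).1 v ∈ W F n) :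
    Nat.card ↥((W F l).comap (g.1 : TwoSided F →ₗ[F] TwoSided F) ⊓ segment F m n) =
      Nat.card ↥(W F l ⊓ segment F m n) := by
  -- Both cardinalities are volumes measured in units of `W_m`, and `g` preserves volume.
  have e1 := addHaar_submodule (X := (W F l).comap (g.1 : TwoSided F →ₗ[F] TwoSided F))
    (m := m) (n := n) h1 (fun v hv => by
      have := h2 _ hv
      change (g⁻¹).1 (g.1 v) ∈ W F n at this
      rwa [inv_apply_apply] at this)
  have e2 := addHaar_submodule (X := W F l) (W_mono hml) (W_mono hmn)
  rw [addHaar_preimage_W g _ (isOpen_W l), e2] at e1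
  have := (ENNReal.mul_left_inj (addHaar_W_ne_zero m) (addHaar_W_ne_top m)).mp e1
  exact_mod_cast this.symm

theorem nonempty_linearEquiv_of_card_eq {K X Y : Type*} [Field K] [Finite K] [AddCommGroup X]
    [AddCommGroup Y] [Module K X] [Module K Y] [Finite X] [Finite Y]
    (h : Nat.card X = Nat.card Y) : Nonempty (X ≃ₗ[K] Y) := by
  refine FiniteDimensional.nonempty_linearEquiv_of_finrank_eq ?_
  rw [Module.natCard_eq_pow_finrank (K := K) (V := X),
    Module.natCard_eq_pow_finrank (K := K) (V := Y)] at h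
  exact Nat.pow_right_injective (Finite.one_lt_card (α := K)) h

/-- The operators with finite support are dense: each coset `g Q_α` contains one. -/
theorem exists_isSupportedIn_mem_Q (g : GLbar F) (α : Seg) :
    ∃ (a b : ℤ) (g' : GLbar F), IsSupportedIn g' a b ∧ g⁻¹ * g' ∈ Q F α := by
  obtain ⟨k1, hk1⟩ := exists_W_le_comap g⁻¹ α.lo
  obtain ⟨k2, hk2⟩ := exists_map_W_le g α.hi
  -- The segment (a, b] is chosen so large that `g⁻¹ W_a ⊆ W_{α₋}` and `g W_{α₊} ⊆ W_b`; modulo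
  -- `W_{α₋}` everything relevant to the coset `g Q_α` then happens inside it.
  obtain ⟨a, ha1, ha2⟩ : ∃ a, a ≤ k1 ∧ a ≤ α.lo := ⟨min k1 α.lo, min_le_left _ _, min_le_right _ _⟩
  obtain ⟨b, hb1, hb2⟩ : ∃ b, k2 ≤ b ∧ α.hi ≤ b := ⟨max k2 α.hi, le_max_left _ _, le_max_right _ _⟩
  have hle := α.le
  have hlo := hk1 a ha1
  have hhi := hk2 b hb1
  have hcard := card_comap_inf_segment g⁻¹ (l := α.lo) (m := a) (n := b) (by omega) ha2 hlo
    (fun v hv => by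
      rw [inv_inv]
      exact hhi v (W_mono hle hv))
  -- `B` is the part of `g W_{α₋}` supported in (a, b]. By `hcard` it has the same dimension as the
  -- sequences supported in (a, α₋].
  set B : Submodule F (TwoSided F) :=
    (W F α.lo).comap ((g⁻¹).1 : TwoSided F →ₗ[F] TwoSided F) ⊓ segment F a b
  have hfB : Finite B := Finite.of_injective _ (Submodule.inclusion_injective (inf_le_right))
  have hfW : Finite ↥(W F α.lo ⊓ segment F a b) :=
    Finite.of_injective _ (Submodule.inclusion_injective (inf_le_right))
  obtain ⟨φ⟩ := nonempty_linearEquiv_of_card_eq (K := F) hcard.symm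
  have hpr : ∀ v, trunc F a α.lo v ∈ W F α.lo ⊓ segment F a b := fun v =>
    ⟨segment_le_W le_rfl (trunc_mem_segment _ _ v),
      segment_mono le_rfl (by omega) (trunc_mem_segment _ _ v)⟩
  -- The finite model of `g`: coordinates in (a, α₋] go to `B` by an arbitrary isomorphism, which
  -- suffices modulo `W_{α₋}`; coordinates in (α₋, α₊] go where `g` sends them, truncated to (a, b].
  let f₀ : TwoSided F →ₗ[F] TwoSided F :=
    B.subtype ∘ₗ φ.toLinearMap ∘ₗ (trunc F a α.lo).codRestrict _ hpr +
      trunc F a b ∘ₗ (g.1 : TwoSided F →ₗ[F] TwoSided F) ∘ₗ trunc F α.lo α.hi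
  have f₀_apply : ∀ v, f₀ v = φ ⟨trunc F a α.lo v, hpr v⟩ +
    trunc F a b (g.1 (trunc F α.lo α.hi v)) := fun v => rfl
  have hf₀ : ∀ v, f₀ v ∈ segment F a b := fun v =>
    add_mem (φ ⟨_, hpr v⟩).2.2 (trunc_mem_segment _ _ _)
  have hinvB : ∀ w ∈ B, (g⁻¹).1 w ∈ W F α.lo := fun w hw => hw.1
  have htr : ∀ v, (g⁻¹).1 (trunc F a b (g.1 (trunc F α.lo α.hi v))) - trunc F α.lo α.hi v ∈
      W F α.lo := fun v => by
    have h1 := hlo _ (sub_trunc_mem_W (a := a)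
      (hhi _ (segment_le_W le_rfl (trunc_mem_segment α.lo α.hi v))))
    rw [map_sub, inv_apply_apply] at h1
    have := neg_mem h1
    rwa [neg_sub] at this
  have hinv : ∀ v, (g⁻¹).1 (f₀ v) - trunc F α.lo α.hi v ∈ W F α.lo := fun v => by
    rw [f₀_apply, map_add, add_sub_assoc]
    exact add_mem (hinvB _ (φ ⟨_, hpr v⟩).2) (htr v)
  let D : Submodule F (segment F a b) := (W F α.hi).comap (segment F a b).subtype
  let f : D →ₗ[F] segment F a b :=
    (f₀.codRestrict _ hf₀) ∘ₗ (segment F a b).subtype ∘ₗ D.subtype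
  -- Applying `g⁻¹` modulo `W_{α₋}` recovers the coordinates in (α₋, α₊]; once these vanish,
  -- injectivity of `φ` removes the remaining ones.
  have hf : Function.Injective f := by
    refine (injective_iff_map_eq_zero f).mpr fun d hd => ?_
    have hd0 : f₀ d = 0 := congrArg Subtype.val hd
    have h1 := hinv d
    rw [hd0, map_zero, zero_sub] at h1
    have h2 : trunc F α.lo α.hi (d : TwoSided F) = 0 :=
      eq_zero_of_mem_segment_of_mem_W (trunc_mem_segment _ _ _) (neg_mem_iff.mp h1)
    rw [f₀_apply, h2, map_zero g.1, map_zero, add_zero] at hd0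
    have h3 : φ ⟨trunc F a α.lo (d : TwoSided F), hpr d⟩ = 0 := Subtype.ext hd0
    have h4 : trunc F a α.lo (d : TwoSided F) = 0 :=
      congrArg Subtype.val ((LinearEquiv.map_eq_zero_iff φ).mp h3)
    refine Subtype.ext (Subtype.ext (TwoSided.ext fun j => ?_))
    change ((d : segment F a b) : TwoSided F) j = 0
    by_cases hj : a < j ∧ j ≤ b
    · by_cases hj1 : j ≤ α.lo
      · have := congrArg (fun w : TwoSided F => w j) h4
        simpa [trunc_apply, hj.1, hj1] using this
      · by_cases hj2 : j ≤ α.hi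
        · have := congrArg (fun w : TwoSided F => w j) h2
          simpa [trunc_apply, not_le.mp hj1, hj2] using this
        · exact d.2 j (not_le.mp hj2)
    · exact d.1.2 j hj
  have : FiniteDimensional F (segment F a b) := Module.Finite.of_finite
  obtain ⟨A, hA⟩ := exists_linearEquiv_extend D f hf
  refine ⟨a, b, blockGL a b A, isSupportedIn_blockGL a b A, mem_Q_of_sub_mem fun v hv => ?_⟩
  change (g⁻¹).1 (blockLin a b A.toLinearMap v) - v ∈ W F α.lo
  have hvb := W_mono hb2 hv
  have hAv : ((A : segment F a b →ₗ[F] segment F a b)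
      ⟨trunc F a b v, trunc_mem_segment a b v⟩ : TwoSided F) = f₀ (trunc F a b v) :=
    congrArg Subtype.val (hA ⟨⟨trunc F a b v, trunc_mem_segment a b v⟩, by
      intro j hj
      change trunc F a b v j = 0
      rw [trunc_apply, hv j hj, ite_self]⟩)
  rw [blockLin_apply, hAv, map_add]
  -- Three errors, each in `W_{α₋}`: cutting `v` off at `a`, replacing `g` by `f₀`, and dropping the
  -- coordinates in (a, α₋].
  have h1 := hlo _ (sub_trunc_mem_W (a := a) hvb)
  have h2 := hinv (trunc F a b v)
  have h3 : trunc F α.lo α.hi (trunc F a b v) - v ∈ W F α.lo := fun j hj => by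
    rw [TwoSided.sub_apply, trunc_apply, trunc_apply]
    by_cases hj2 : j ≤ α.hi
    · rw [if_pos ⟨hj, hj2⟩, if_pos ⟨by omega, by omega⟩, sub_self]
    · rw [if_neg (by omega), hv j (by omega), sub_zero]
  have := add_mem h1 (add_mem h2 h3)
  convert this using 1
  abel

/-! ### Coordinate permutations and conjugacy of swaps. -/

section Perm

/-- The permutations of `ℤ` that fix all indices far away from `0`. -/
def boundedPerm : Subgroup (Equiv.Perm ℤ) where
  carrier := {σ | ∃ N : ℤ, ∀ j, N < |j| → σ j = j}
  one_mem' := ⟨0, fun _ _ => rfl⟩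
  mul_mem' := by
    rintro σ τ ⟨M, hM⟩ ⟨N, hN⟩
    refine ⟨max M N, fun j hj => ?_⟩
    rw [Equiv.Perm.mul_apply, hN j ((le_max_right _ _).trans_lt hj),
      hM j ((le_max_left _ _).trans_lt hj)]
  inv_mem' := by
    rintro σ ⟨M, hM⟩
    exact ⟨M, fun j hj => by rw [Equiv.Perm.inv_eq_iff_eq, hM j hj]⟩

variable {F : Type*} [Field F]

/-- Permutation of the coordinates. -/
def permLin (F : Type*) [Field F] (σ : boundedPerm) : TwoSided F →ₗ[F] TwoSided F where
  toFun v := ⟨fun j => v (σ.1 j), by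
    obtain ⟨m, hm⟩ := v.2
    obtain ⟨N, hN⟩ := σ.2
    refine ⟨max m N, fun j hj => ?_⟩
    have h1 := (le_max_right m N).trans_lt hj
    change v (σ.1 j) = 0
    rw [hN j (h1.trans_le (le_abs_self j))]
    exact hm j ((le_max_left _ _).trans_lt hj)⟩
  map_add' _ _ := rfl
  map_smul' _ _ := rfl

theorem permLin_mem_W {σ : boundedPerm} {m : ℤ} (h : ∀ j, σ.1 j ≤ m ↔ j ≤ m) (v : TwoSided F) :
    permLin F σ v ∈ W F m ↔ v ∈ W F m := by
  constructor
  · intro hv j hj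
    have := hv (σ.1⁻¹ j) (by
      by_contra h'
      have := (h _).mpr (not_lt.mp h')
      rw [show σ.1 (σ.1⁻¹ j) = j from σ.1.apply_symm_apply j] at this
      omega)
    change v (σ.1 (σ.1⁻¹ j)) = 0 at this
    rwa [show σ.1 (σ.1⁻¹ j) = j from σ.1.apply_symm_apply j] at this
  · intro hv j hj
    refine hv _ ?_
    by_contra h'
    have := (h _).mp (not_lt.mp h')
    omega

theorem exists_forall_perm_le_iff (σ : boundedPerm) : ∃ N : ℤ, ∀ m < N, ∀ j, σ.1 j ≤ m ↔ j ≤ m := by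
  obtain ⟨N, hN⟩ := σ.2
  refine ⟨min (-N) 0, fun m hm j => ?_⟩
  constructor
  · intro h
    have := hN (σ.1 j) (by rw [abs_of_neg] <;> omega)
    rw [σ.1.injective this] at h
    exact h
  · intro h
    rw [hN j (by rw [abs_of_neg] <;> omega)]
    exact h

theorem continuous_permLin (σ : boundedPerm) : Continuous (permLin F σ) := by
  obtain ⟨N, hN⟩ := exists_forall_perm_le_iff σ
  exact continuous_of_W _ fun n => ⟨min n (N - 1), fun v hv =>
    W_mono (min_le_left _ _) ((permLin_mem_W (hN _ (by omega)) v).mpr hv)⟩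

variable [Finite F]

/-- Permutation of the coordinates as a continuous operator. -/
def permEquiv (F : Type*) [Field F] (σ : boundedPerm) : TwoSided F ≃L[F] TwoSided F where
  toLinearEquiv := LinearEquiv.ofLinearMap (permLin F σ) (permLin F σ⁻¹)
    (LinearMap.ext fun v => TwoSided.ext fun j => congrArg v (σ.1.symm_apply_apply j))
    (LinearMap.ext fun v => TwoSided.ext fun j => congrArg v (σ.1.apply_symm_apply j))
  continuous_toFun := continuous_permLin σ
  continuous_invFun := continuous_permLin σ⁻¹

/-- Permutation of the coordinates as an element of the group. -/
def permGL (F : Type*) [Field F] [Finite F] (σ : boundedPerm) : GLbar F :=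
  ⟨permEquiv F σ, by
    obtain ⟨N, hN⟩ := exists_forall_perm_le_iff σ
    exact mem_GLbar_of_W _ (N - 1) (permLin_mem_W (hN _ (by omega)))⟩

theorem permGL_apply (σ : boundedPerm) (v : TwoSided F) (j : ℤ) :
    (permGL F σ).1 v j = v (σ.1 j) := rfl

/-- The order is reversed because coordinates are pulled back along the permutation. -/
theorem permGL_mul (σ τ : boundedPerm) : permGL F σ * permGL F τ = permGL F (τ * σ) :=
  Subtype.ext (ContinuousLinearEquiv.ext (funext fun _ => rfl))

theorem permGL_mem_Q {σ : boundedPerm} {α : Seg}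
    (h2 : ∀ j, α.hi < j → α.hi < σ.1 j) (h3 : ∀ j, α.lo < j → j ≤ α.hi → σ.1 j = j) :
    permGL F σ ∈ Q F α :=
  mem_Q_of_sub_mem fun v hv j hj => by
    rw [TwoSided.sub_apply, permGL_apply]
    by_cases h : j ≤ α.hi
    · rw [h3 j hj h, sub_self]
    · rw [hv j (by omega), hv _ (h2 j (by omega)), sub_self]

/-- The permutation underlying `swapGL`. -/
def swapPerm (α : Seg) (k : ℕ) : boundedPerm :=
  ⟨Function.Involutive.toPerm (swapFun α k) (swapFun_swapFun α k),
    |α.hi| + |α.lo| + k, fun j hj => by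
      change swapFun α k j = j
      have h1 := abs_le.mp (le_refl |α.hi|)
      have h2 := abs_le.mp (le_refl |α.lo|)
      rcases lt_abs.mp hj with h | h
      · exact swapFun_of_lt _ _ _ (by omega)
      · exact swapFun_of_le _ _ _ (by omega)⟩

theorem swapPerm_apply (α : Seg) (k : ℕ) (j : ℤ) : (swapPerm α k).1 j = swapFun α k j := rfl

theorem swapGL_eq_permGL (α : Seg) (k : ℕ) : swapGL F α k = permGL F (swapPerm α k) :=
  Subtype.ext (ContinuousLinearEquiv.ext (funext fun _ => rfl))

/-- A piecewise translation: the permutation that exchanges neighbouring segments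
`(a, a + m]` and `(a + m, a + m + n]`. -/
def rotFun (a : ℤ) (m n : ℕ) (j : ℤ) : ℤ :=
  if a < j ∧ j ≤ a + m then j + n else if a + m < j ∧ j ≤ a + m + n then j - m else j

/-- `rotFun` as a permutation. -/
def rotPerm (a : ℤ) (m n : ℕ) : boundedPerm :=
  ⟨⟨rotFun a m n, rotFun a n m,
    fun j => by unfold rotFun; split_ifs <;> omega,
    fun j => by unfold rotFun; split_ifs <;> omega⟩, |a| + m + n, fun j hj => by
      change rotFun a m n j = j
      have h2 := abs_le.mp (le_refl |a|)
      unfold rotFun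
      rcases lt_abs.mp hj with h | h <;> split_ifs <;> omega⟩

theorem rotPerm_apply (a : ℤ) (m n : ℕ) (j : ℤ) : (rotPerm a m n).1 j = rotFun a m n j := rfl

theorem swap_mem_boundedPerm (a b : ℤ) : Equiv.swap a b ∈ boundedPerm :=
  ⟨|a| + |b|, fun j hj => Equiv.swap_apply_of_ne_of_ne
    (by rintro rfl; have := abs_nonneg b; omega) (by rintro rfl; have := abs_nonneg a; omega)⟩

/-- The transposition of two indices. -/
def transp (a b : ℤ) : boundedPerm := ⟨Equiv.swap a b, swap_mem_boundedPerm a b⟩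

theorem swapPerm_one (α : Seg) : swapPerm α 1 = transp (α.hi + 1) α.lo := by
  refine Subtype.ext (Equiv.ext fun j => ?_)
  have := α.le
  rw [swapPerm_apply]
  change _ = Equiv.swap _ _ j
  rw [Equiv.swap_apply_def]
  unfold swapFun
  split_ifs <;> omega

theorem rotFun_left {a : ℤ} {m n : ℕ} {j : ℤ} (h1 : a < j) (h2 : j ≤ a + m) :
    rotFun a m n j = j + n := if_pos ⟨h1, h2⟩

theorem rotFun_right {a : ℤ} {m n : ℕ} {j : ℤ} (h1 : a + m < j) (h2 : j ≤ a + m + n) :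
    rotFun a m n j = j - m := by
  unfold rotFun
  rw [if_neg (by omega), if_pos ⟨h1, h2⟩]

theorem rotFun_outside {a : ℤ} {m n : ℕ} {j : ℤ} (h : j ≤ a ∨ a + m + n < j) :
    rotFun a m n j = j := by
  unfold rotFun
  rw [if_neg (by omega), if_neg (by omega)]

theorem swapFun_left {α : Seg} {k : ℕ} {j : ℤ} (h1 : α.lo - k < j) (h2 : j ≤ α.lo) :
    swapFun α k j = j + (α.hi - α.lo + k) := if_pos ⟨h1, h2⟩

theorem swapFun_right {α : Seg} {k : ℕ} {j : ℤ} (h1 : α.hi < j) (h2 : j ≤ α.hi + k) :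
    swapFun α k j = j - (α.hi - α.lo + k) := by
  have := α.le
  unfold swapFun
  rw [if_neg (by omega), if_pos ⟨h1, h2⟩]

/-- The exchange of `k` coordinates next to a far larger segment `β` is conjugate to the one
next to `α`. -/
theorem exists_perm_swapPerm_far (α β : Seg) (k : ℕ) (h1 : β.lo ≤ α.lo - k) (h2 : α.hi + k ≤ β.hi) :
    ∃ p : boundedPerm, permGL F p ∈ Q F α ∧
      permGL F p * swapGL F α k = swapGL F β k * permGL F p := by
  obtain ⟨m, hm⟩ := Int.eq_ofNat_of_zero_le (a := α.lo - k - (β.lo - k)) (by omega)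
  obtain ⟨n, hn⟩ := Int.eq_ofNat_of_zero_le (a := β.hi - α.hi) (by omega)
  have := α.le
  have := β.le
  -- The left rotation takes (β₋ - k, β₋] to (α₋ - k, α₋], the right one takes (β₊, β₊ + k] to (α₊,
  -- α₊ + k]. Both preserve order on these blocks and fix (α₋, α₊].
  refine ⟨rotPerm (β.lo - k) k m * rotPerm α.hi n k, permGL_mem_Q ?_ ?_, ?_⟩
  · intro j hj
    change _ < rotFun _ _ _ (rotFun _ _ _ j)
    unfold rotFun
    split_ifs <;> omega
  · intro j hj hj'
    change rotFun _ _ _ (rotFun _ _ _ j) = j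
    unfold rotFun
    split_ifs <;> omega
  · rw [swapGL_eq_permGL, swapGL_eq_permGL, permGL_mul, permGL_mul]
    congr 1
    refine Subtype.ext (Equiv.ext fun j => ?_)
    change swapFun α k (rotFun _ _ _ (rotFun _ _ _ j)) =
      rotFun _ _ _ (rotFun _ _ _ (swapFun β k j))
    by_cases hA : β.lo - k < j ∧ j ≤ β.lo
    · rw [rotFun_outside (a := α.hi) (j := j) (by omega), rotFun_left (by omega) (by omega),
        swapFun_left (by omega) (by omega), swapFun_left (by omega) (by omega),
        rotFun_right (a := α.hi) (by omega) (by omega), rotFun_outside (by omega)]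
      omega
    by_cases hB : β.lo < j ∧ j ≤ α.lo
    · rw [rotFun_outside (a := α.hi) (j := j) (by omega), rotFun_right (by omega) (by omega),
        swapFun_of_le _ _ _ (by omega), swapFun_of_mem _ _ _ (by omega),
        rotFun_outside (a := α.hi) (by omega), rotFun_right (by omega) (by omega)]
    by_cases hC : β.hi < j ∧ j ≤ β.hi + k
    · rw [rotFun_right (a := α.hi) (by omega) (by omega), rotFun_outside (by omega),
        swapFun_right (by omega) (by omega), swapFun_right (by omega) (by omega),
        rotFun_outside (a := α.hi) (by omega), rotFun_left (by omega) (by omega)]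
      omega
    by_cases hD : α.hi < j ∧ j ≤ β.hi
    · rw [rotFun_left (a := α.hi) (by omega) (by omega), rotFun_outside (by omega),
        swapFun_of_lt _ _ _ (by omega), swapFun_of_mem _ _ _ (by omega),
        rotFun_left (a := α.hi) (by omega) (by omega), rotFun_outside (by omega)]
    have hβ : swapFun β k j = j := by
      unfold swapFun
      rw [if_neg (by omega), if_neg (by omega)]
    have hα : swapFun α k j = j := by
      unfold swapFun
      rw [if_neg (by omega), if_neg (by omega)]
    rw [hβ, rotFun_outside (a := α.hi) (by omega), rotFun_outside (by omega), hα]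

/-- The segment `α` enlarged by `k` on both sides. -/
def Seg.enlarge (α : Seg) (k : ℕ) : Seg := ⟨α.lo - k, α.hi + k, by have := α.le; omega⟩

/-- The product and the swap of k + l coordinates exchange the same index sets. They pair them
differently: on the left side the product has its blocks of lengths k and l in the other order, and
a rotation of (α₋ - k - l, α₋] corrects this. -/
theorem exists_perm_swapPerm_add (α : Seg) (k l : ℕ) :
    ∃ p : boundedPerm, permGL F p ∈ Q F α ∧
      permGL F p * (swapGL F (α.enlarge k) l * swapGL F α k) =
        swapGL F α (k + l) * permGL F p := by
  have := α.le
  refine ⟨rotPerm (α.lo - k - l) k l, permGL_mem_Q ?_ ?_, ?_⟩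
  · intro j hj
    rw [rotPerm_apply]
    unfold rotFun
    split_ifs <;> omega
  · intro j hj hj'
    rw [rotPerm_apply]
    unfold rotFun
    split_ifs <;> omega
  · rw [swapGL_eq_permGL, swapGL_eq_permGL, swapGL_eq_permGL, permGL_mul, permGL_mul, permGL_mul]
    congr 1
    refine Subtype.ext (Equiv.ext fun j => ?_)
    change swapFun α k (swapFun (α.enlarge k) l (rotFun _ _ _ j)) =
      rotFun _ _ _ (swapFun α (k + l) j)
    have hlo : (α.enlarge k).lo = α.lo - k := rfl
    have hhi : (α.enlarge k).hi = α.hi + k := rfl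
    by_cases hA : α.lo - k - l < j ∧ j ≤ α.lo - l
    · rw [rotFun_left (by omega) (by omega), swapFun_of_mem (α.enlarge k) _ _ (by omega),
        swapFun_left (by omega) (by omega), swapFun_left (by omega) (by omega),
        rotFun_outside (by omega)]
      omega
    by_cases hB : α.lo - l < j ∧ j ≤ α.lo
    · rw [rotFun_right (by omega) (by omega), swapFun_left (α := α.enlarge k) (by omega) (by omega),
        swapFun_of_lt _ _ _ (by omega), swapFun_left (by omega) (by omega),
        rotFun_outside (by omega)]
      omega
    by_cases hC : α.hi < j ∧ j ≤ α.hi + k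
    · rw [rotFun_outside (by omega), swapFun_of_mem (α.enlarge k) _ _ (by omega),
        swapFun_right (by omega) (by omega), swapFun_right (by omega) (by omega),
        rotFun_left (by omega) (by omega)]
      omega
    by_cases hD : α.hi + k < j ∧ j ≤ α.hi + k + l
    · rw [rotFun_outside (by omega), swapFun_right (α := α.enlarge k) (by omega) (by omega),
        swapFun_of_le _ _ _ (by omega), swapFun_right (by omega) (by omega),
        rotFun_right (by omega) (by omega)]
      omega
    have h1 : swapFun (α.enlarge k) l j = j := by
      unfold swapFun
      rw [if_neg (by omega), if_neg (by omega)]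
    have h2 : ∀ n : ℕ, n ≤ k + l → swapFun α n j = j := fun n hn => by
      unfold swapFun
      rw [if_neg (by omega), if_neg (by omega)]
    rw [rotFun_outside (by omega), h1, h2 k (by omega), h2 _ le_rfl, rotFun_outside (by omega)]

end Perm
-- Hilbert space tools: weak limits, Schur's lemma, fixed points.
/-- Infinitely many vectors of equal norm cannot have a common negative inner product. -/
theorem nonneg_of_forall_inner_eq {H : Type*} [NormedAddCommGroup H] [InnerProductSpace ℂ H]
    {v : ℕ → H} {h : H} {c : ℝ} (hv : ∀ i, ‖v i‖ = ‖h‖)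
    (hc : ∀ i j, i ≠ j → inner ℂ (v i) (v j) = (c : ℂ)) : 0 ≤ c := by
  have key : ∀ n : ℕ, (‖∑ i ∈ Finset.range n, v i‖ : ℝ) ^ 2 = n * ‖h‖ ^ 2 + n * (n - 1) * c := by
    intro n
    induction n with
    | zero => simp
    | succ n ih =>
      rw [Finset.sum_range_succ, norm_add_sq (𝕜 := ℂ), ih, hv, sum_inner,
        Finset.sum_congr rfl fun i hi => hc i n (Finset.mem_range.mp hi).ne]
      simp
      ring
  by_contra! hneg
  obtain ⟨n, hn⟩ := exists_nat_gt (‖h‖ ^ 2 / (-c) + 1)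
  have h1 := key n
  have h2 : ‖h‖ ^ 2 < (n - 1) * (-c) := by
    rw [← div_lt_iff₀ (by linarith)]
    linarith
  have h3 : (0 : ℝ) < n := by
    have : 0 ≤ ‖h‖ ^ 2 / (-c) := div_nonneg (by positivity) (by linarith)
    linarith
  nlinarith [sq_nonneg ‖∑ i ∈ Finset.range n, v i‖]

section Hilbert

variable {H : Type*} [NormedAddCommGroup H] [InnerProductSpace ℂ H] [CompleteSpace H]

/-- A sequence of unitary operators has a weak limit along an ultrafilter. -/
theorem exists_weak_limit (U : ℕ → H ≃ₗᵢ[ℂ] H) (𝓤 : Ultrafilter ℕ) :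
    ∃ S : H →L[ℂ] H, ∀ v w, Tendsto (fun n => inner ℂ (U n v) w) 𝓤 (𝓝 (inner ℂ (S v) w)) := by
  -- Each matrix coefficient stays in a compact disc, so one ultrafilter makes all of them converge
  -- at once; the limits form a bounded sesquilinear form.
  have key : ∀ v w : H, ∃ c ∈ Metric.closedBall (0 : ℂ) (‖v‖ * ‖w‖),
      Tendsto (fun n => inner ℂ (U n v) w) 𝓤 (𝓝 c) := fun v w => by
    refine (isCompact_closedBall (0 : ℂ) (‖v‖ * ‖w‖)).ultrafilter_le_nhds
      (𝓤.map fun n => inner ℂ (U n v) w) ?_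
    refine le_principal_iff.mpr (Filter.mem_map.mpr (Eventually.of_forall fun n => ?_))
    have := norm_inner_le_norm (𝕜 := ℂ) (U n v) w
    rw [LinearIsometryEquiv.norm_map] at this
    simpa using this
  choose B hB hlim using key
  let f : H →ₗ⋆[ℂ] H →ₗ[ℂ] ℂ := LinearMap.mk₂'ₛₗ (starRingEnd ℂ) (RingHom.id ℂ) B
    (fun v v' w => tendsto_nhds_unique (hlim _ _) (by
      simpa only [map_add, inner_add_left] using (hlim v w).add (hlim v' w)))
    (fun c v w => tendsto_nhds_unique (hlim _ _) (by
      simpa only [map_smul, inner_smul_left, smul_eq_mul] using (hlim v w).const_mul _))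
    (fun v w w' => tendsto_nhds_unique (hlim _ _) (by
      simpa only [inner_add_right] using (hlim v w).add (hlim v w')))
    (fun c v w => tendsto_nhds_unique (hlim _ _) (by
      simpa only [inner_smul_right, smul_eq_mul, RingHom.id_apply] using (hlim v w).const_mul _))
  refine ⟨InnerProductSpace.continuousLinearMapOfBilin (f.mkContinuous₂ 1 fun v w => ?_),
    fun v w => ?_⟩
  · have := hB v w
    rw [mem_closedBall_zero_iff] at this
    rw [one_mul]
    exact this
  · rw [InnerProductSpace.continuousLinearMapOfBilin_apply]
    exact hlim v w

/-- A self-adjoint operator, all of whose commuting bounded operators leave no proper closed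
subspace invariant, is a scalar. -/
theorem exists_eq_smul_of_isSelfAdjoint [Nontrivial H] {S : H →L[ℂ] H} (hS : IsSelfAdjoint S)
    (h : ∀ K : Submodule ℂ H, IsClosed (K : Set H) →
      (∀ A : H →L[ℂ] H, Commute S A → ∀ x ∈ K, A x ∈ K) → K = ⊥ ∨ K = ⊤) :
    ∃ r : ℝ, ∀ x, S x = (r : ℂ) • x := by
  obtain ⟨r, hr⟩ := ContinuousFunctionalCalculus.spectrum_nonempty (R := ℝ) S hS
  have hsub : ∀ s ∈ spectrum ℝ S, s = r := by
    by_contra! hs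
    obtain ⟨s, hs, hsr⟩ := hs
    obtain ⟨f, g, hf, hg, hfg, hfr, hgs⟩ : ∃ (f g : ℝ → ℝ), Continuous f ∧
        Continuous g ∧ (∀ t, f t * g t = 0) ∧ f r ≠ 0 ∧ g s ≠ 0 := by
      refine ⟨fun t => max 0 (|r - s| / 2 - |t - r|), fun t => max 0 (|r - s| / 2 - |t - s|),
        by fun_prop, by fun_prop, fun t => ?_, ?_, ?_⟩
      · rcases le_total (|r - s| / 2) |t - r| with h1 | h1
        · simp [max_eq_left (sub_nonpos.mpr h1)]
        · have h2 : |r - s| / 2 ≤ |t - s| := by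
            have := abs_sub_le r t s
            rw [abs_sub_comm r t] at this
            linarith
          simp [max_eq_left (sub_nonpos.mpr h2)]
      · have : 0 < |r - s| := abs_pos.mpr (sub_ne_zero.mpr hsr.symm)
        simp [this]
      · have : 0 < |r - s| := abs_pos.mpr (sub_ne_zero.mpr hsr.symm)
        simp [this]
    have hne : ∀ (f : ℝ → ℝ) (t : ℝ), Continuous f → t ∈ spectrum ℝ S → f t ≠ 0 →
        cfc f S ≠ 0 := fun f t hf ht hft h0 => by
      have h1 : f t ∈ spectrum ℝ (cfc f S) := by
        rw [cfc_map_spectrum f S hS hf.continuousOn]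
        exact Set.mem_image_of_mem f ht
      rw [h0, spectrum.zero_eq] at h1
      exact hft h1
    have hmul : cfc f S * cfc g S = 0 := by
      rw [← cfc_mul f g S hf.continuousOn hg.continuousOn]
      simp only [hfg]
      exact cfc_const_zero ℝ S
    have hker : ∀ A : H →L[ℂ] H, Commute S A →
        ∀ x ∈ LinearMap.ker ((cfc f S : H →L[ℂ] H) : H →ₗ[ℂ] H),
        A x ∈ LinearMap.ker ((cfc f S : H →L[ℂ] H) : H →ₗ[ℂ] H) := fun A hA x hx => by
      have h2 := congrArg (fun T : H →L[ℂ] H => T x) (hA.cfc_real f).eq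
      have hx' : cfc f S x = 0 := hx
      change cfc f S (A x) = A (cfc f S x) at h2
      rw [hx', map_zero] at h2
      exact h2
    rcases h (LinearMap.ker ((cfc f S : H →L[ℂ] H) : H →ₗ[ℂ] H)) (cfc f S).isClosed_ker hker
      with h1 | h1
    · refine hne g s hg hs hgs (ContinuousLinearMap.ext fun x => ?_)
      have : cfc g S x ∈ LinearMap.ker ((cfc f S : H →L[ℂ] H) : H →ₗ[ℂ] H) :=
        LinearMap.mem_ker.mpr (congrArg (fun T : H →L[ℂ] H => T x) hmul)
      rw [h1] at this
      exact this
    · refine hne f r hf hr hfr (ContinuousLinearMap.ext fun x => ?_)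
      have : x ∈ LinearMap.ker ((cfc f S : H →L[ℂ] H) : H →ₗ[ℂ] H) := by rw [h1]; trivial
      exact this
  refine ⟨r, fun x => ?_⟩
  have h1 : S = cfc (fun _ => r) S := by
    conv_lhs => rw [← cfc_id ℝ S]
    exact cfc_congr fun t ht => hsub t ht
  rw [cfc_const r S] at h1
  rw [h1, Algebra.algebraMap_eq_smul_one]
  simp

/-- A closed convex set stable under a set of isometries contains a common fixed point. -/
theorem exists_fixed_of_convex {ι : Type*} (U : ι → H ≃ₗᵢ[ℂ] H) {C : Set H} (hne : C.Nonempty)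
    (hcl : IsClosed C) (hC : Convex ℝ C) (hU : ∀ i, ∀ x ∈ C, U i x ∈ C) :
    ∃ x ∈ C, ∀ i, U i x = x := by
  let : InnerProductSpace ℝ H := InnerProductSpace.complexToReal
  obtain ⟨x, hx, hmin⟩ := exists_norm_eq_iInf_of_complete_convex hne hcl.isComplete hC 0
  have hle : ∀ y ∈ C, ‖x‖ ≤ ‖y‖ := fun y hy => by
    rw [zero_sub, norm_neg] at hmin
    rw [hmin]
    have := ciInf_le (f := fun w : C => ‖(0 : H) - w‖) ⟨0, by rintro _ ⟨w, rfl⟩; positivity⟩ ⟨y, hy⟩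
    simpa using this
  refine ⟨x, hx, fun i => ?_⟩
  -- `x` has minimal norm in `C`. The midpoint of `x` and `U i x` is no shorter, so the
  -- parallelogram law forces `U i x = x`.
  have h1 := hle _ (hC (hU i x hx) hx (by norm_num : (0 : ℝ) ≤ 1 / 2)
    (by norm_num : (0 : ℝ) ≤ 1 / 2) (by norm_num))
  rw [← smul_add, norm_smul] at h1
  have h2 := parallelogram_law_with_norm ℂ (U i x) x
  rw [LinearIsometryEquiv.norm_map] at h2
  norm_num at h1
  have h3 : ‖U i x - x‖ * ‖U i x - x‖ ≤ 0 := by nlinarith [norm_nonneg x]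
  have h4 : ‖U i x - x‖ = 0 := by nlinarith [norm_nonneg (U i x - x)]
  exact sub_eq_zero.mp (norm_eq_zero.mp h4)

end Hilbert

/-! ### Matrix coefficients at `Q_α`-fixed vectors. -/

namespace UnitaryRep

section Inner

variable {F : Type*} [Field F] [Finite F]
  {H : Type*} [NormedAddCommGroup H] [InnerProductSpace ℂ H] (ρ : UnitaryRep F H)

theorem apply_mul (a b : GLbar F) (x : H) : ρ (a * b) x = ρ a (ρ b x) := by
  rw [map_mul]
  rfl

theorem apply_inv_apply (a : GLbar F) (x : H) : ρ a (ρ a⁻¹ x) = x := by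
  rw [← apply_mul, mul_inv_cancel, map_one]
  rfl

theorem inner_apply_left (a : GLbar F) (x y : H) :
    inner ℂ (ρ a x) y = inner ℂ x (ρ a⁻¹ y) := by
  conv_lhs => rw [← ρ.apply_inv_apply a y]
  exact LinearIsometryEquiv.inner_map_map _ _ _

theorem inner_apply_involution {a : GLbar F} (ha : a * a = 1) (x y : H) :
    inner ℂ (ρ a x) y = inner ℂ x (ρ a y) := by
  rw [inner_apply_left, inv_eq_of_mul_eq_one_left ha]

/-- Matrix coefficients at `Q_α`-fixed vectors do not change under conjugation by `Q_α`. -/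
theorem inner_eq_of_conj {α : Seg} {p a b : GLbar F} (hp : p ∈ Q F α) (h : p * a = b * p)
    {x y : H} (hx : x ∈ ρ.fixed α) (hy : y ∈ ρ.fixed α) :
    inner ℂ (ρ a x) y = inner ℂ (ρ b x) y := by
  conv_rhs => rw [← hx p hp, ← apply_mul, ← h, apply_mul, inner_apply_left,
    hy _ (inv_mem hp)]

theorem fixed_mono {α β : Seg} (h1 : β.lo ≤ α.lo) (h2 : α.hi ≤ β.hi) : ρ.fixed α ≤ ρ.fixed β :=
  fun _ hx g hg => hx g (Q_anti h1 h2 hg)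

theorem swapGL_mul_self (α : Seg) (k : ℕ) : swapGL F α k * swapGL F α k = 1 :=
  Subtype.ext (ContinuousLinearEquiv.ext (funext (swapLin_swapLin α k)))

theorem swapGL_zero (α : Seg) : swapGL F α 0 = 1 :=
  Subtype.ext (ContinuousLinearEquiv.ext (funext fun v => TwoSided.ext fun j => by
    rw [swapGL_apply]
    have : swapFun α 0 j = j := by
      unfold swapFun
      split_ifs <;> omega
    rw [this]
    rfl))

theorem exists_norm_sub_lt (x : H) {ε : ℝ} (hε : 0 < ε) :
    ∃ α : Seg, ∀ g ∈ Q F α, ‖ρ g x - x‖ < ε := by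
  have h1 := (ρ.continuous' x).continuousAt (x := 1)
  have h2 : {g | ‖ρ g x - x‖ < ε} ∈ 𝓝 (1 : GLbar F) := by
    have := h1 (Metric.ball_mem_nhds _ hε)
    have e : ρ (1 : GLbar F) x = x := by
      rw [map_one]
      rfl
    change _ ∈ 𝓝 (1 : GLbar F) at this
    simp only [e] at this
    refine Filter.mem_of_superset this fun g hg => ?_
    exact mem_ball_iff_norm.mp hg
  obtain ⟨α, hα⟩ := exists_Q_subset h2
  exact ⟨α, fun g hg => hα hg⟩

/-- A closed subspace that is invariant under the operators with finite support is invariant. -/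
theorem mem_of_isSupportedIn {K : Submodule ℂ H} (hK : IsClosed (K : Set H))
    (h : ∀ (a b : ℤ) (g : GLbar F), IsSupportedIn g a b → ∀ x ∈ K, ρ g x ∈ K) (g : GLbar F)
    {x : H} (hx : x ∈ K) : ρ g x ∈ K := by
  refine hK.closure_subset_iff.mpr subset_rfl (Metric.mem_closure_iff.mpr fun ε hε => ?_)
  obtain ⟨α, hα⟩ := ρ.exists_norm_sub_lt x hε
  obtain ⟨a, b, g', hg', hq⟩ := exists_isSupportedIn_mem_Q g α
  refine ⟨ρ g' x, h a b g' hg' x hx, ?_⟩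
  have h1 := hα _ hq
  rwa [← LinearIsometryEquiv.norm_map (ρ g), map_sub, ← apply_mul, mul_inv_cancel_left,
    ← dist_eq_norm, dist_comm] at h1

variable {ρ}

/-- `ρ(ζ)` of a fixed vector of `Q_α` is fixed by a smaller subgroup. -/
theorem swapGL_mem_fixed {α : Seg} {x : H} (hx : x ∈ ρ.fixed α) (k : ℕ) :
    ρ (swapGL F α k) x ∈ ρ.fixed (α.enlarge k) := fun g hg => by
  have hJ := swapGL_mul_self (F := F) α k
  -- The swap preserves `W_{α₊ + k}` and takes `W_{α₋ - k}` into `W_{α₋}`, so it conjugates the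
  -- smaller subgroup into `Q_α`.
  have hq : swapGL F α k * g * swapGL F α k ∈ Q F α := mem_Q_of_sub_mem fun v hv j hj => by
    set w := (swapGL F α k).1 v with hw
    have hw1 : w ∈ W F (α.enlarge k).hi := fun i hi => by
      have hi' : α.hi + k < i := hi
      rw [hw, swapGL_apply, swapFun_of_lt _ _ _ hi']
      exact hv i (by omega)
    have h1 := hg.2.2 w hw1
    have h2 : (swapGL F α k * g * swapGL F α k).1 v - v = (swapGL F α k).1 (g.1 w - w) := by
      rw [map_sub]
      congr 1
      exact (swapLin_swapLin α k v).symm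
    rw [h2, swapGL_apply]
    refine h1 _ ?_
    change α.lo - k < _
    unfold swapFun
    split_ifs <;> omega
  conv_rhs => rw [← hx _ hq, ← apply_mul, ← mul_assoc, ← mul_assoc, hJ, one_mul, apply_mul]

/-- The scalars attached to `ζ^k` are multiplicative in `k`. -/
theorem inner_swapGL_add {α : Seg} {k l : ℕ} {r s : ℝ}
    (hr : ∀ (α : Seg), ∀ x ∈ ρ.fixed α, ∀ y ∈ ρ.fixed α,
      inner ℂ (ρ (swapGL F α k) x) y = r * inner ℂ x y)
    (hs : ∀ (α : Seg), ∀ x ∈ ρ.fixed α, ∀ y ∈ ρ.fixed α,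
      inner ℂ (ρ (swapGL F α l) x) y = s * inner ℂ x y)
    {x y : H} (hx : x ∈ ρ.fixed α) (hy : y ∈ ρ.fixed α) :
    inner ℂ (ρ (swapGL F α (k + l)) x) y = (r * s : ℝ) * inner ℂ x y := by
  obtain ⟨p, hp, hconj⟩ := exists_perm_swapPerm_add (F := F) α k l
  -- After the first swap, both vectors are fixed by the subgroup of the enlarged segment, so the
  -- second swap contributes the factor `s` there.
  rw [← ρ.inner_eq_of_conj hp hconj hx hy, apply_mul,
    hs (α.enlarge k) _ (swapGL_mem_fixed hx k) y
      (ρ.fixed_mono (sub_le_self _ (by positivity)) (le_add_of_nonneg_right (by positivity)) hy),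
    hr α x hx y hy]
  push_cast
  ring

theorem transp_mem_Q {α : Seg} {i j : ℤ} (hi : i ≤ α.lo) (hj : j ≤ α.lo) :
    permGL F (transp i j) ∈ Q F α := by
  have := α.le
  have h : ∀ n, α.lo < n → (transp i j).1 n = n := fun n hn =>
    Equiv.swap_apply_of_ne_of_ne (by omega) (by omega)
  exact permGL_mem_Q (fun n hn => by rwa [h n (by omega)]) fun n hn _ => h n hn

/-- Let s_i be the transposition of α₊ + 1 and α₋ - i. Transpositions of indices up to α₋ lie in
`Q_α` and conjugate the s_i to each other, so ⟨s_i x, x⟩ does not depend on i. As s_j s_i = t s_j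
with such a transposition t, also ⟨s_i x, s_j x⟩ = ⟨s_j x, x⟩ for i ≠ j: infinitely many vectors of
equal norm with common inner product r‖x‖². -/
theorem nonneg_of_inner_swapGL_one {α : Seg} {x : H} (hx : x ∈ ρ.fixed α) (hx0 : x ≠ 0) {r : ℝ}
    (hr : inner ℂ (ρ (swapGL F α 1) x) x = r * inner ℂ x x) : 0 ≤ r := by
  have hle := α.le
  let s : ℕ → boundedPerm := fun i => transp (α.hi + 1) (α.lo - i)
  have hs : ∀ i, inner ℂ (ρ (permGL F (s i)) x) x = ((r * ‖x‖ ^ 2 : ℝ) : ℂ) := fun i => by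
    have hconj : permGL F (transp α.lo (α.lo - i)) * permGL F (transp (α.hi + 1) α.lo) =
        permGL F (s i) * permGL F (transp α.lo (α.lo - i)) := by
      rw [permGL_mul, permGL_mul]
      congr 1
      refine Subtype.ext ?_
      change Equiv.swap _ _ * Equiv.swap _ _ = Equiv.swap _ _ * Equiv.swap _ _
      rw [Equiv.mul_swap_eq_swap_mul (Equiv.swap α.lo (α.lo - i)), Equiv.swap_apply_right,
        Equiv.swap_apply_of_ne_of_ne (by omega) (by omega)]
    rw [← ρ.inner_eq_of_conj (transp_mem_Q le_rfl (by omega)) hconj hx hx, ← swapPerm_one,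
      ← swapGL_eq_permGL, hr, inner_self_eq_norm_sq_to_K]
    push_cast
    rfl
  have h0 : 0 ≤ r * ‖x‖ ^ 2 := by
    refine nonneg_of_forall_inner_eq (v := fun i => ρ (permGL F (s i)) x) (h := x)
      (fun i => LinearIsometryEquiv.norm_map _ _) fun i j hij => ?_
    have hsj : permGL F (s j) * permGL F (s j) = 1 := by
      rw [permGL_mul]
      have : s j * s j = 1 := Subtype.ext (Equiv.swap_mul_self _ _)
      rw [this]
      rfl
    have hconj : permGL F (s j) * permGL F (s i) =
        permGL F (transp (α.lo - i) (α.lo - j)) * permGL F (s j) := by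
      rw [permGL_mul, permGL_mul]
      congr 1
      refine Subtype.ext ?_
      change Equiv.swap _ _ * Equiv.swap _ _ = Equiv.swap _ _ * Equiv.swap _ _
      rw [Equiv.mul_swap_eq_swap_mul (Equiv.swap (α.hi + 1) (α.lo - j)), Equiv.swap_apply_right,
        Equiv.swap_apply_of_ne_of_ne (by omega) (by omega), Equiv.swap_comm (α.lo - i)]
    rw [← ρ.inner_apply_involution hsj, ← apply_mul, hconj, apply_mul, inner_apply_left,
      hx _ (inv_mem (transp_mem_Q (by omega) (by omega))), hs]
  by_contra! hneg
  have := norm_pos_iff.mpr hx0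
  nlinarith [mul_neg_of_neg_of_pos hneg (pow_pos this 2)]

end Inner

/-! ### Existence of fixed vectors, and scalar action of the swaps. -/

variable {F : Type*} [Field F] [Finite F]
  {H : Type*} [NormedAddCommGroup H] [InnerProductSpace ℂ H] [CompleteSpace H]
  (ρ : UnitaryRep F H)

/-- By continuity some `Q_α` moves `x` by less than ‖x‖/2. The closed convex hull of the orbit then
avoids 0, and its element of least norm is fixed by `Q_α`. -/
theorem exists_mem_fixed_ne_zero [Nontrivial H] : ∃ α : Seg, ∃ x ∈ ρ.fixed α, x ≠ 0 := by
  obtain ⟨x, hx⟩ := exists_ne (0 : H)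
  obtain ⟨α, hα⟩ := ρ.exists_norm_sub_lt x (ε := ‖x‖ / 2) (by positivity)
  let C : Set H := closedConvexHull ℝ (Set.range fun g : Q F α => ρ g.1 x)
  have hCb : C ⊆ Metric.closedBall x (‖x‖ / 2) := by
    refine closedConvexHull_min ?_ (convex_closedBall _ _) Metric.isClosed_closedBall
    rintro _ ⟨g, rfl⟩
    exact mem_closedBall_iff_norm.mpr (hα g.1 g.2).le
  have hCU : ∀ q : Q F α, ∀ y ∈ C, ρ q.1 y ∈ C := fun q => by
    refine closedConvexHull_min (t := (ρ q.1) ⁻¹' C) ?_ ?_ ?_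
    · rintro _ ⟨g, rfl⟩
      refine subset_closedConvexHull ⟨q * g, ?_⟩
      exact ρ.apply_mul q.1 g.1 x
    · exact (convex_closedConvexHull (𝕜 := ℝ)).linear_preimage
        ((ρ q.1).toLinearEquiv.toLinearMap.restrictScalars ℝ)
    · exact isClosed_closedConvexHull.preimage (ρ q.1).continuous
  obtain ⟨y, hy, hfix⟩ := exists_fixed_of_convex (fun q : Q F α => ρ q.1)
    (C := C) ⟨_, subset_closedConvexHull ⟨1, rfl⟩⟩ isClosed_closedConvexHull
    convex_closedConvexHull hCU
  refine ⟨α, y, fun g hg => hfix ⟨g, hg⟩, ?_⟩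
  rintro rfl
  have h1 := hCb hy
  rw [mem_closedBall_iff_norm, zero_sub, norm_neg] at h1
  have := norm_pos_iff.mpr hx
  linarith

/-- The segment `(-n, n]`. -/
def symmSeg (n : ℕ) : Seg := ⟨-n, n, by omega⟩

variable {ρ}

/-- The double coset `ζ_α^k` acts by a real scalar that does not depend on `α`. -/
theorem IsIrreducible.exists_inner_swapGL (hρ : ρ.IsIrreducible) (k : ℕ) :
    ∃ r : ℝ, ∀ (α : Seg), ∀ x ∈ ρ.fixed α, ∀ y ∈ ρ.fixed α,
      inner ℂ (ρ (swapGL F α k) x) y = r * inner ℂ x y := by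
  have := hρ.1
  obtain ⟨S, hS⟩ := exists_weak_limit (fun n => ρ (swapGL F (symmSeg n) k)) (hyperfilter ℕ)
  have hatTop : ((hyperfilter ℕ : Ultrafilter ℕ) : Filter ℕ) ≤ atTop := Nat.hyperfilter_le_atTop
  have hsa : IsSelfAdjoint S := by
    rw [ContinuousLinearMap.isSelfAdjoint_iff_isSymmetric]
    intro x y
    refine tendsto_nhds_unique (hS x y) ?_
    have := (Complex.continuous_conj.tendsto _).comp (hS y x)
    simp only [Function.comp_def, inner_conj_symm] at this
    refine this.congr fun n => ?_
    rw [inner_apply_involution ρ (swapGL_mul_self _ _)]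
  -- For n beyond |a| and |b| the swap at (-n, n] commutes with `g`, and the limit ignores the other
  -- n.
  have hcomm : ∀ (a b : ℤ) (g : GLbar F), IsSupportedIn g a b → ∀ x, S (ρ g x) = ρ g (S x) := by
    intro a b g hg x
    refine ext_inner_right ℂ fun y => ?_
    rw [inner_apply_left]
    refine tendsto_nhds_unique (hS _ _) ((hS _ _).congr' ?_)
    refine hatTop ((eventually_ge_atTop (max a.natAbs b.natAbs)).mono fun n hn => ?_)
    have h1 := (le_max_left _ _).trans hn
    have h2 := (le_max_right _ _).trans hn
    change inner ℂ (ρ _ x) (ρ g⁻¹ y) = inner ℂ (ρ _ (ρ g x)) y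
    rw [← inner_apply_left, ← apply_mul, ← apply_mul, hg.commute_swapGL]
    · change -(n : ℤ) ≤ a
      omega
    · change b ≤ n
      omega
  -- A closed subspace stable under everything commuting with `S` is stable under the finitely
  -- supported operators, hence by density under the whole group.
  obtain ⟨r, hr⟩ := exists_eq_smul_of_isSelfAdjoint hsa fun K hK hKS =>
    hρ.2 K hK fun g x hx => ρ.mem_of_isSupportedIn hK (fun a b g' hg' =>
      hKS (ρ g').toContinuousLinearEquiv.toContinuousLinearMap
        (ContinuousLinearMap.ext fun y => hcomm a b g' hg' y)) g hx
  refine ⟨r, fun α x hx y hy => ?_⟩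
  have h1 : inner ℂ (S x) y = r * inner ℂ x y := by
    rw [hr, inner_smul_left, Complex.conj_ofReal]
  rw [← h1]
  -- On `H_α` the matrix coefficients are constant for large n, so the weak limit equals the
  -- coefficient of the swap at α itself.
  refine tendsto_nhds_unique (tendsto_const_nhds.congr' ?_) (hS x y)
  refine hatTop ((eventually_ge_atTop (α.lo.natAbs + α.hi.natAbs + k)).mono fun n hn => ?_)
  obtain ⟨p, hp, hconj⟩ := exists_perm_swapPerm_far (F := F) α (symmSeg n) k
    (by change -(n : ℤ) ≤ _; omega) (by change _ ≤ (n : ℤ); omega)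
  exact ρ.inner_eq_of_conj hp hconj hx hy

/-- The action of `ζ_α^k` on `H_α` in terms of matrix coefficients. -/
theorem hat_zetaCoset_eq_smul_iff (α : Seg) (k : ℕ) (c : ℂ) :
    ρ.hat α α (zetaCoset F α k) = c • ContinuousLinearMap.id ℂ (ρ.fixed α) ↔
      ∀ x ∈ ρ.fixed α, ∀ y ∈ ρ.fixed α,
        inner ℂ y (ρ (swapGL F α k) x) = c * inner ℂ y x := by
  have hc : ∀ x y : ρ.fixed α, inner ℂ y (ρ.hat α α (zetaCoset F α k) x) =
      inner ℂ (y : H) (ρ (swapGL F α k) x) := fun x y =>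
    Submodule.inner_orthogonalProjectionOnto_eq_of_mem_left _ _
  constructor
  · intro h x hx y hy
    have := hc ⟨x, hx⟩ ⟨y, hy⟩
    rw [h] at this
    rw [← this, _root_.smul_apply, inner_smul_right]
    rfl
  · intro h
    refine ContinuousLinearMap.ext fun x => ext_inner_left ℂ fun y => ?_
    rw [hc, h x x.2 y y.2, _root_.smul_apply, inner_smul_right]
    rfl

end UnitaryRep

end FqGL

end

/-! ### The spherical character. -/

/-- An irreducible unitary representation has exactly one spherical character `z`, and `z` is a real
number with `0 ≤ z ≤ 1`. -/
theorem lemma1p7 {F : Type*} [Field F] [Finite F]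
    {H : Type*} [NormedAddCommGroup H] [InnerProductSpace ℂ H] [CompleteSpace H]
    (ρ : FqGL.UnitaryRep F H) (hρ : ρ.IsIrreducible) :
    ∃ z : ℝ, (∀ w : ℂ, ρ.IsSphericalCharacter w ↔ w = (z : ℂ)) ∧ 0 ≤ z ∧ z ≤ 1 := by
  have := hρ.1
  obtain ⟨α, x, hx, hx0⟩ := ρ.exists_mem_fixed_ne_zero
  choose r hr using hρ.exists_inner_swapGL
  have hxx : inner ℂ x x ≠ 0 := inner_self_ne_zero.mpr hx0
  have hr0 : r 0 = 1 := by
    have h1 := hr 0 α x hx x hx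
    rw [FqGL.UnitaryRep.swapGL_zero, map_one] at h1
    exact_mod_cast (mul_eq_right₀ hxx).mp h1.symm
  have hadd : ∀ k, r (k + 1) = r k * r 1 := fun k => by
    have h1 := FqGL.UnitaryRep.inner_swapGL_add (hr k) (hr 1) hx hx
    rw [hr (k + 1) α x hx x hx] at h1
    exact_mod_cast mul_right_cancel₀ hxx h1
  have hpow : ∀ k, r k = r 1 ^ k := fun k => by
    induction k with
    | zero => rw [hr0, pow_zero]
    | succ k ih => rw [hadd, ih, pow_succ]
  refine ⟨r 1, fun w => ⟨fun hw => ?_, ?_⟩,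
    FqGL.UnitaryRep.nonneg_of_inner_swapGL_one hx hx0 (hr 1 α x hx x hx), ?_⟩
  · have h1 := (FqGL.UnitaryRep.hat_zetaCoset_eq_smul_iff α 1 _).mp (hw α 1) x hx x hx
    have h2 := hr 1 α x hx x hx
    -- The inner product is conjugate-linear on the left. Moving the involution to the right slot
    -- compares `w` itself, not its conjugate, with `r 1`.
    rw [ρ.inner_apply_involution (FqGL.UnitaryRep.swapGL_mul_self α 1), h1, pow_one] at h2
    exact mul_right_cancel₀ hxx h2
  · rintro rfl β k
    refine (FqGL.UnitaryRep.hat_zetaCoset_eq_smul_iff β k _).mpr fun u hu v hv => ?_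
    rw [← ρ.inner_apply_involution (FqGL.UnitaryRep.swapGL_mul_self β k), hr k β v hv u hu, hpow]
    push_cast
    rfl
  -- Cauchy–Schwarz for `x` and its image of equal norm gives |r 1| ≤ 1.
  · have h1 := norm_inner_le_norm (𝕜 := ℂ) (ρ (FqGL.swapGL F α 1) x) x
    rw [hr 1 α x hx x hx, LinearIsometryEquiv.norm_map, norm_mul, Complex.norm_real,
      inner_self_eq_norm_sq_to_K] at h1
    have h2 : 0 < ‖x‖ := norm_pos_iff.mpr hx0
    have h3 : ‖((‖x‖ : ℂ)) ^ 2‖ = ‖x‖ * ‖x‖ := by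
      rw [norm_pow, Complex.norm_real, norm_norm, sq]
    have h4 : ‖r 1‖ * (‖x‖ * ‖x‖) ≤ ‖x‖ * ‖x‖ := by
      rw [← h3]
      rw [← h3] at h1
      exact h1
    exact (le_abs_self _).trans (le_of_mul_le_mul_right (by simpa using h4) (mul_pos h2 h2))
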